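/- **Model.** A line network has links $1,\dots,L$ ($L\ge 2$) joining a source $v_0$, interior nodes $v_1,\dots,v_{L-1}$ and a sink $v_L$. Time is slotted; in every slot each link carries one transmission, and a transmission over link $i$ is received with probability $p_i\in(0,1]$, independently over slots and links (deterministic regular transmissions, Bernoulli losses); the pattern of successes is the *traffic*. The parameters are unequal: $p_i\ne p_j$ for $i\neq j$. Put $p=\min_{1\le i\le L}p_i$ and $\gamma_e=\min_{1<i\le L}|p_i-p_{i-1}|$. Let $0<\gamma_a,\gamma_b,\gamma_c<1$ be constants with $\beta:=(1+\gamma_a)\gamma_b<1$. The $k$ message packets are first encoded by a *precode*, an erasure code with $n_k=q\alpha$ code symbols ($q=q_k$, $\alpha=\alpha_k$), called intermediate packets, that corrects every pattern of at most $\beta n_k$ erasures, and that has rate $1-\beta$ (capacity-achieving): $k/n_k\to1-\beta$ as $k\to\infty$. The intermediate packets are divided into $q$ *chunks* of size $\alpha$. For each transmission the sending node chooses one of the $q$ chunks uniformly at random; the source sends a uniformly random $\mathbb F_2$-linear combination of the $\alpha$ packets of that chunk, and an interior node sends a uniformly random $\mathbb F_2$-linear combination of the packets of that chunk that it received in earlier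 slots. All these choices are independent of each other and of the traffic; together they form the *code*. The sink decodes a chunk once it has received $\alpha$ packets of the chunk with linearly independent global encoding vectors. The *coding delay* is the least number of slots after which the intermediate packets of the decoded chunks determine the message. The *average coding delay* of a code is the expectation of its coding delay over the random traffic, for that fixed code; it is a random variable through the random choice of the code. **Theorem.** There are a function $\rho(\gamma_a,\gamma_b)=O(\gamma_b^2)$ (more precisely, for each $b_0<1$ there is $K$ such that $|\rho(\gamma_a,\gamma_b)|\le K\gamma_b^2$ whenever $(1+\gamma_a)\gamma_b\le b_0$) and a positive nondecreasing function $C$ on $\mathbb R$ such that the following holds for all $L\ge 2$, all unequal $p_1,\dots,p_L$ and all $\gamma_a,\gamma_b,\gamma_c$ as above. Let $\varepsilon_k\in(0,\varepsilon_0]$ with $\varepsilon_0<1$, and suppose that the chunk sizes $\alpha=\alpha_k$ satisfy $$\alpha_k\ \ge\ C\!\left(\tfrac{\gamma_e}{\gamma_c}\right)\frac{L}{\gamma_e^2\gamma_c}\log\frac{L}{\gamma_b\gamma_c}\quad\text{for all large }k,\qquad\qquad \frac{\alpha_k^2}{\gamma_a^2\gamma_b^2}=o\!\left(\frac{k}{\log(1/\varepsilon_k)}\right)\quad(k\to\infty).$$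 Then, for all sufficiently large $k$, the average coding delay of the random chunked code with precoding is larger than $$(1+\gamma_c)\bigl(1+(1+\gamma_a)\gamma_b+\rho(\gamma_a,\gamma_b)\bigr)\frac kp$$ with probability at most $\varepsilon_k$. In other words, the constant implied by $\alpha=\Omega\bigl(\tfrac{L}{\gamma_e^2\gamma_c}\log\tfrac{L}{\gamma_b\gamma_c}\bigr)$ does not depend on $k,L,\gamma_a,\gamma_b,\varepsilon$, and it depends on the $p_i$ and $\gamma_c$ only through the ratio $\gamma_e/\gamma_c$: it is uniform as long as $\gamma_e/\gamma_c$ stays bounded, and for a fixed constant $\gamma_c$ it is at most $C(1/\gamma_c)$. -/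

import Mathlib

open MeasureTheory ProbabilityTheory Filter Topology
open scoped ENNReal BigOperators

universe u

noncomputable section

namespace ChunkedCode

/- A line network with `L` links joins the nodes `0, 1, …, L` (source `0`, sink `L`); the link
`i : Fin L` goes from node `i` to node `i + 1`.  Time is slotted: in each slot `0, 1, 2, …` every
link carries exactly one transmission (deterministic regular transmissions).  The chunked code has
`q` chunks of `a` packets each, over the field with two elements `ZMod 2`. -/

/-- A traffic: `T (s, i) = true` iff the packet sent over link `i` in slot `s` is received. -/
abbrev Traffic (L : ℕ) : Type := ℕ × Fin L → Bool

/-- The choices made by a node for one transmission: the chunk, the coefficients of the packets of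
that chunk (used by the source node), and the coefficients of the previously received packets,
labelled by the slot in which they were received (used by the interior nodes). -/
abbrev Choice (q a : ℕ) : Type := Fin q × (Fin a → ZMod 2) × (ℕ → ZMod 2)

/-- A code: the choices of all nodes in all slots.  `C (s, i)` is used over link `i` in slot `s`. -/
abbrev Code (L q a : ℕ) : Type := ℕ × Fin L → Choice q a

/-- Bernoulli losses with success parameters `p i`, independent over slots and links. -/
def trafficLaw {L : ℕ} (p : Fin L → unitInterval) : Measure (Traffic L) :=
  Measure.infinitePi fun x : ℕ × Fin L => bernoulliMeasure true false (p x.2)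

/-- The uniform probability measure on a nonempty finite type. -/
def uniformLaw (X : Type) [Fintype X] [Nonempty X] [MeasurableSpace X] : Measure X :=
  (PMF.uniformOfFintype X).toMeasure

instance (X : Type) [Fintype X] [Nonempty X] [MeasurableSpace X] :
    IsProbabilityMeasure (uniformLaw X) := by
  unfold uniformLaw
  infer_instance

/-- One random choice: a uniform chunk and independent uniform coefficients in `ZMod 2`. -/
def choiceLaw (q a : ℕ) [NeZero q] : Measure (Choice q a) :=
  (uniformLaw (Fin q)).prod
    ((Measure.infinitePi fun _ : Fin a => uniformLaw (ZMod 2)).prod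
      (Measure.infinitePi fun _ : ℕ => uniformLaw (ZMod 2)))

instance (q a : ℕ) [NeZero q] : IsProbabilityMeasure (choiceLaw q a) := by
  unfold choiceLaw
  infer_instance

/-- A random code: independent random choices over all slots and links. -/
def codeLaw (L q a : ℕ) [NeZero q] : Measure (Code L q a) :=
  Measure.infinitePi fun _ : ℕ × Fin L => choiceLaw q a

/-- The global encoding vector, relative to the packets of its chunk `(C (t, i)).1`, of the packet
sent over link `i` in slot `t`.  The source combines the `a` packets of the chunk; an interior node
combines the packets of that chunk which it received in earlier slots. -/
def packet {L q a : ℕ} (C : Code L q a) (T : Traffic L) :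
    (i : ℕ) → i < L → ℕ → (Fin a → ZMod 2)
  | 0, h, t => (C (t, ⟨0, h⟩)).2.1
  | i + 1, h, t =>
      ∑ s ∈ Finset.range t,
        if T (s, ⟨i, Nat.lt_of_succ_lt h⟩) = true ∧
            (C (s, ⟨i, Nat.lt_of_succ_lt h⟩)).1 = (C (t, ⟨i + 1, h⟩)).1 then
          (C (t, ⟨i + 1, h⟩)).2.2 s • packet C T i (Nat.lt_of_succ_lt h) s
        else 0

/-- The global encoding vectors of the packets of chunk `j` received by the sink in the first `t`
slots. -/
def sinkVectors {L q a : ℕ} (C : Code L q a) (T : Traffic L) (t : ℕ) (j : Fin q) :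
    Set (Fin a → ZMod 2) :=
  {v | ∃ s < t, ∃ i : Fin L, (i : ℕ) + 1 = L ∧ T (s, i) = true ∧ (C (s, i)).1 = j ∧
    v = packet C T i i.isLt s}

/-- The sink can decode chunk `j` after `t` slots: the received packets of the chunk contain `a`
linearly independent ones, i.e. they span. -/
def ChunkDecodable {L q a : ℕ} (C : Code L q a) (T : Traffic L) (t : ℕ) (j : Fin q) : Prop :=
  Submodule.span (ZMod 2) (sinkVectors C T t j) = ⊤

/-- An erasure code with `k` message symbols and code symbols labelled by the finite set `ι`
corrects every pattern of erasures of at most a fraction `b` of the code symbols. -/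
def CorrectsErasures {k : ℕ} {ι F : Type*} [Fintype ι] (enc : (Fin k → F) → (ι → F)) (b : ℝ) :
    Prop :=
  ∀ S : Finset ι, (S.card : ℝ) ≤ b * Fintype.card ι →
    ∀ m m' : Fin k → F, (∀ j, j ∉ S → enc m j = enc m' j) → m = m'

/-- With the precode `enc` (whose code symbols are the intermediate packets, `a` in each of the `q`
chunks), the message can be recovered at the sink after `t` slots: the intermediate packets in the
decodable chunks determine the message. -/
def Recovered {L q a k : ℕ} {F : Type*} (enc : (Fin k → F) → (Fin q × Fin a → F))
    (C : Code L q a) (T : Traffic L) (t : ℕ) : Prop :=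
  ∀ m m' : Fin k → F,
    (∀ j : Fin q, ChunkDecodable C T t j → ∀ x : Fin a, enc m (j, x) = enc m' (j, x)) → m = m'

/-- The coding delay of the code `C` with precode `enc` over the traffic `T`: the least number of
slots after which the message can be recovered (`∞` if there is none). -/
def codingDelay {L q a k : ℕ} {F : Type*} (enc : (Fin k → F) → (Fin q × Fin a → F))
    (C : Code L q a) (T : Traffic L) : ℝ≥0∞ :=
  ⨅ (t : ℕ) (_ : Recovered enc C T t), (t : ℝ≥0∞)

/-- The average coding delay of the code `C`: the coding delay averaged over the traffics, but not
over the codes. -/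
def averageCodingDelay {L q a k : ℕ} {F : Type*} (p : Fin L → unitInterval)
    (enc : (Fin k → F) → (Fin q × Fin a → F)) (C : Code L q a) : ℝ≥0∞ :=
  ∫⁻ T, codingDelay enc C T ∂(trafficLaw p)

/-- The least traffic parameter. -/
def minParam {L : ℕ} (p : Fin L → unitInterval) : ℝ := ⨅ i, (p i : ℝ)

/-- The least difference `|p_i - p_{i-1}|` between the parameters of consecutive links. -/
def minGap {L : ℕ} (p : Fin L → unitInterval) : ℝ :=
  ⨅ e : {e : Fin L × Fin L // (e.1 : ℕ) + 1 = e.2}, |(p e.1.2 : ℝ) - (p e.1.1 : ℝ)|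

end ChunkedCode

end

/-! A chunk is undecodable exactly when some nonzero functional `φ` kills all its vectors at the
sink. Follow the last node at which `φ` has been detected (`position`). Each time the link leaving
that node delivers a packet of the chunk, fresh coefficients make `φ` nonzero on it with probability
1/2 (`lintegral_factor_resample`). So `φ` advances by fair coin flips and survives only with fewer
than `L` heads. A product of one factor per slot (`weight`) has expectation at most one
(`lintegral_weight_le_one`); Markov's inequality and a union bound over at most `2 ^ a` functionals
bound the failure probability of a chunk.

To count coins, time is cut into about `40 L / g` windows, `g` being `γc`. By Chernoff every link
delivers nearly its mean number of packets in every window, and a surviving `φ` moves in fewer than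
`L` windows, so it sees at least `(1 + g / 8) a` coins. This beats `2 ^ a` once `a` is of order `L
g⁻³ log (L / (γb g))`: after about `(1 + g / 4) q a / p` slots each chunk fails with probability at
most `γb` (`measure_not_chunkDecodable_le_of_size`).

One transmission affects at most two chunks, so McDiarmid's inequality makes it unlikely that more
than `(1 + γa) γb q` chunks are undecoded at that time (`measure_undecoded_ge_le_exp`); otherwise
the precode finishes. The excess delay is at most the number of later slots with too many undecoded
chunks. Its mean over traffic and code is small: the little-o hypothesis makes the McDiarmid
exponent a large multiple of `log (1 / ε)`, which covers the slots up to a cutoff, and a cruder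
exponential bound covers the rest. Markov's inequality over the code concludes
(`codeLaw_averageCodingDelay_gt_le`).

Finally `q a` is asymptotic to `k / (1 - β)`, and `ρ` is the remainder of `1 / (1 - β)` after `1 +
β`. -/

namespace ChunkedCode

/-! ### Resampling one coordinate of a product measure -/

section Resampling

/-- A product measure is determined by its values on boxes, and overwriting coordinate `i` pulls a
box back to a box in which the `i`-th side sits in the second factor. -/
theorem measurePreserving_update {ι : Type*} [DecidableEq ι] {X : ι → Type*}
    [∀ i, MeasurableSpace (X i)] (μ : ∀ i, Measure (X i)) [∀ i, IsProbabilityMeasure (μ i)]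
    (i : ι) :
    MeasurePreserving (fun z : (∀ i, X i) × X i => Function.update z.1 i z.2)
      ((Measure.infinitePi μ).prod (μ i)) (Measure.infinitePi μ) := by
  have hm : Measurable fun z : (∀ i, X i) × X i => Function.update z.1 i z.2 := by
    rw [measurable_pi_iff]
    intro k
    by_cases h : k = i
    · subst h
      simpa using measurable_snd
    · simp only [Function.update_of_ne h]
      fun_prop
  refine ⟨hm, Measure.eq_infinitePi _ fun s t ht => ?_⟩
  rw [Measure.map_apply hm (MeasurableSet.pi s.countable_toSet fun k _ => ht k)]
  by_cases hi : i ∈ s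
  · have : (fun z : (∀ i, X i) × X i => Function.update z.1 i z.2) ⁻¹' Set.pi s t
        = (Set.pi (s.erase i : Finset ι) t) ×ˢ (t i) := by
      ext ⟨f, e⟩
      simp only [Set.mem_preimage, Set.mem_pi, Set.mem_prod, Finset.mem_coe, Finset.mem_erase]
      constructor
      · intro h
        refine ⟨fun k hk => ?_, ?_⟩
        · have := h k hk.2
          rwa [Function.update_of_ne hk.1] at this
        · simpa using h i hi
      · rintro ⟨h1, h2⟩ k hk
        by_cases hki : k = i
        · subst hki; simpa using h2
        · rw [Function.update_of_ne hki]; exact h1 k ⟨hki, hk⟩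
    rw [this, Measure.prod_prod, Measure.infinitePi_pi _ fun k _ => ht k,
      Finset.prod_erase_mul _ _ hi]
  · have : (fun z : (∀ i, X i) × X i => Function.update z.1 i z.2) ⁻¹' Set.pi s t
        = (Set.pi s t) ×ˢ Set.univ := by
      ext ⟨f, e⟩
      simp only [Set.mem_preimage, Set.mem_pi, Set.mem_prod, Finset.mem_coe, Set.mem_univ, and_true]
      refine forall₂_congr fun k hk => ?_
      rw [Function.update_of_ne (show k ≠ i from fun h => hi (by rw [← h]; exact hk))]
    rw [this, Measure.prod_prod, Measure.infinitePi_pi _ fun k _ => ht k]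
    simp

theorem lintegral_update {ι : Type*} [DecidableEq ι] {X : ι → Type*}
    [∀ i, MeasurableSpace (X i)] (μ : ∀ i, Measure (X i)) [∀ i, IsProbabilityMeasure (μ i)]
    (i : ι) {H : (∀ i, X i) → ℝ≥0∞} (hH : Measurable H) :
    ∫⁻ f, ∫⁻ e, H (Function.update f i e) ∂(μ i) ∂(Measure.infinitePi μ)
      = ∫⁻ f, H f ∂(Measure.infinitePi μ) := by
  have h := measurePreserving_update μ i
  rw [← h.lintegral_comp hH]
  exact (lintegral_prod _ (hH.comp h.measurable).aemeasurable).symm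

/-- The choices and the losses of all transmissions. -/
abbrev Sample (L q a : ℕ) : Type := Traffic L × Code L q a

instance {L : ℕ} (p : Fin L → unitInterval) : IsProbabilityMeasure (trafficLaw p) := by
  unfold trafficLaw; infer_instance

instance (L q a : ℕ) [NeZero q] : IsProbabilityMeasure (codeLaw L q a) := by
  unfold codeLaw; infer_instance

/-- The joint law of the traffic and the code. -/
noncomputable def sampleLaw {L : ℕ} (p : Fin L → unitInterval) (q a : ℕ) [NeZero q] :
    Measure (Sample L q a) :=
  (trafficLaw p).prod (codeLaw L q a)

instance {L : ℕ} (p : Fin L → unitInterval) (q a : ℕ) [NeZero q] :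
    IsProbabilityMeasure (sampleLaw p q a) := by
  unfold sampleLaw; infer_instance

/-- The law of a single transmission. -/
noncomputable def slotLaw (p : unitInterval) (q a : ℕ) [NeZero q] : Measure (Bool × Choice q a) :=
  (bernoulliMeasure true false p).prod (choiceLaw q a)

instance (p : unitInterval) (q a : ℕ) [NeZero q] : IsProbabilityMeasure (slotLaw p q a) := by
  unfold slotLaw; infer_instance

/-- Replace the outcome of the transmission `x`. -/
def resample {L q a : ℕ} (ω : Sample L q a) (x : ℕ × Fin L) (e : Bool × Choice q a) :
    Sample L q a :=
  (Function.update ω.1 x e.1, Function.update ω.2 x e.2)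

theorem measurable_update_pair {ι : Type*} [DecidableEq ι] {X : Type*} [MeasurableSpace X]
    (i : ι) : Measurable fun z : (ι → X) × X => Function.update z.1 i z.2 := by
  rw [measurable_pi_iff]
  intro k
  by_cases h : k = i
  · subst h
    simpa using measurable_snd
  · simp only [Function.update_of_ne h]
    fun_prop

theorem measurable_resample {L q a : ℕ} (x : ℕ × Fin L) :
    Measurable fun z : Sample L q a × (Bool × Choice q a) => resample z.1 x z.2 := by
  unfold resample
  exact ((measurable_update_pair x).comp
      ((measurable_fst.comp measurable_fst).prodMk (measurable_fst.comp measurable_snd))).prodMk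
    ((measurable_update_pair x).comp
      ((measurable_snd.comp measurable_fst).prodMk (measurable_snd.comp measurable_snd)))

/-- This plays the role of conditional expectation throughout: the outcome of `x` may be averaged
first with all other outcomes frozen. Loss and choice live in different factors, so
`lintegral_update` is used once for each. -/
theorem lintegral_resample {L q a : ℕ} [NeZero q] (p : Fin L → unitInterval) (x : ℕ × Fin L)
    {H : Sample L q a → ℝ≥0∞} (hH : Measurable H) :
    ∫⁻ ω, ∫⁻ e, H (resample ω x e) ∂(slotLaw (p x.2) q a) ∂(sampleLaw p q a)
      = ∫⁻ ω, H ω ∂(sampleLaw p q a) := by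
  have h1 : Measurable fun z : Sample L q a × (Bool × Choice q a) => H (resample z.1 x z.2) :=
    hH.comp (measurable_resample x)
  have h2 : Measurable fun ω : Sample L q a =>
      ∫⁻ e, H (resample ω x e) ∂(slotLaw (p x.2) q a) := h1.lintegral_prod_right'
  unfold sampleLaw
  rw [lintegral_prod _ h2.aemeasurable, lintegral_prod _ hH.aemeasurable]
  have h3 : ∀ T : Traffic L, ∀ C : Code L q a,
      ∫⁻ e, H (resample (T, C) x e) ∂(slotLaw (p x.2) q a)
        = ∫⁻ b, ∫⁻ c, H (Function.update T x b, Function.update C x c) ∂(choiceLaw q a)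
          ∂(bernoulliMeasure true false (p x.2)) := by
    intro T C
    unfold slotLaw
    rw [lintegral_prod _ (by
      exact (h1.comp (measurable_const.prodMk measurable_id)).aemeasurable)]
    rfl
  simp_rw [h3]
  have h4 : ∀ T : Traffic L,
      ∫⁻ C, ∫⁻ b, ∫⁻ c, H (Function.update T x b, Function.update C x c) ∂(choiceLaw q a)
          ∂(bernoulliMeasure true false (p x.2)) ∂(codeLaw L q a)
        = ∫⁻ b, ∫⁻ C, H (Function.update T x b, C) ∂(codeLaw L q a)
          ∂(bernoulliMeasure true false (p x.2)) := by
    intro T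
    rw [lintegral_lintegral_swap]
    · refine lintegral_congr fun b => ?_
      exact lintegral_update (fun _ : ℕ × Fin L => choiceLaw q a) x
        (H := fun C => H (Function.update T x b, C)) (hH.comp (measurable_const.prodMk measurable_id))
    · have : Measurable fun z : (Code L q a × Bool) × Choice q a =>
          H (Function.update T x z.1.2, Function.update z.1.1 x z.2) :=
        h1.comp ((measurable_const.prodMk (measurable_fst.comp measurable_fst)).prodMk
          ((measurable_snd.comp measurable_fst).prodMk measurable_snd))
      exact this.lintegral_prod_right'.aemeasurable
  simp_rw [h4]
  exact lintegral_update (fun x : ℕ × Fin L => bernoulliMeasure true false (p x.2)) x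
    (H := fun T => ∫⁻ C, H (T, C) ∂(codeLaw L q a)) hH.lintegral_prod_right'

end Resampling

/-! ### Integrals over a single transmission -/

section OneTransmission

theorem lintegral_uniformLaw (X : Type) [Fintype X] [Nonempty X] [MeasurableSpace X]
    [MeasurableSingletonClass X] (f : X → ℝ≥0∞) :
    ∫⁻ x, f x ∂(uniformLaw X) = (∑ x, f x) / Fintype.card X := by
  unfold uniformLaw
  rw [lintegral_fintype, ENNReal.div_eq_inv_mul, Finset.mul_sum]
  refine Finset.sum_congr rfl fun x _ => ?_
  rw [PMF.toMeasure_apply_singleton _ _ (measurableSet_singleton x)]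
  simp [PMF.uniformOfFintype_apply, mul_comm]

theorem lintegral_uniformLaw_zmod (f : ZMod 2 → ℝ≥0∞) :
    ∫⁻ x, f x ∂(uniformLaw (ZMod 2)) = (f 0 + f 1) / 2 := by
  rw [lintegral_uniformLaw, ZMod.card]
  exact congrArg (· / _) (Fin.sum_univ_two f)

/-- A function of uniform bits that is flipped with one of them is a uniform bit. -/
theorem lintegral_uniform_bit {κ : Type*} [DecidableEq κ] (g : (κ → ZMod 2) → ZMod 2)
    (hg : Measurable g) (k : κ)
    (hk : ∀ c e, g (Function.update c k e) = g (Function.update c k 0) + e) (x y : ℝ≥0∞) :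
    ∫⁻ c, (if g c ≠ 0 then x else y) ∂(Measure.infinitePi fun _ : κ => uniformLaw (ZMod 2))
      = (x + y) / 2 := by
  classical
  have hm : Measurable fun c : κ → ZMod 2 => if g c ≠ 0 then x else y :=
    Measurable.ite (hg (MeasurableSet.of_discrete (s := {z | z ≠ 0}))) measurable_const
      measurable_const
  -- Rerandomise bit `k` alone: exactly one of its two values makes `g` nonzero.
  rw [← lintegral_update (fun _ : κ => uniformLaw (ZMod 2)) k hm]
  have : ∀ c : κ → ZMod 2,
      ∫⁻ e, (if g (Function.update c k e) ≠ 0 then x else y) ∂(uniformLaw (ZMod 2))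
        = (x + y) / 2 := by
    intro c
    rw [lintegral_uniformLaw_zmod, hk c 1]
    obtain h | h : g (Function.update c k 0) = 0 ∨ g (Function.update c k 0) = 1 := by
      generalize g (Function.update c k 0) = z
      revert z; decide
    · rw [h, if_neg (by decide), if_pos (by decide), add_comm]
    · rw [h, if_pos (by decide), if_neg (by decide)]
  simp_rw [this]
  simp

/-- Reception and the choice of chunk `j` are independent, with joint probability `p / q`. The
hypothesis `h` says that `ψ ≠ 0` is a fair coin; it is kept abstract so that source and interior
nodes share the computation. -/
theorem lintegral_slotLaw {q a : ℕ} [NeZero q] (p : unitInterval) (j : Fin q)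
    (ψ : (Fin a → ZMod 2) × (ℕ → ZMod 2) → ZMod 2) (hψ : Measurable ψ) (x y z : ℝ≥0∞)
    (h : ∫⁻ d, (if ψ d ≠ 0 then x else y) ∂((Measure.infinitePi fun _ : Fin a => uniformLaw (ZMod 2)).prod
      (Measure.infinitePi fun _ : ℕ => uniformLaw (ZMod 2))) = (x + y) / 2) :
    ∫⁻ e, (if e.1 = true ∧ e.2.1 = j then (if ψ e.2.2 ≠ 0 then x else y) else z)
        ∂(slotLaw p q a)
      = ENNReal.ofReal (p / q) * ((x + y) / 2) + ENNReal.ofReal (1 - p / q) * z := by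
  have hq : (0 : ℝ) < q := by exact_mod_cast Nat.pos_of_ne_zero (NeZero.ne q)
  have hq1 : (1 : ℝ) ≤ q := by exact_mod_cast Nat.pos_of_ne_zero (NeZero.ne q)
  have mψ : MeasurableSet {d | ψ d ≠ 0} := hψ (MeasurableSet.of_discrete (s := {z | z ≠ 0}))
  have m1 : Measurable fun d => if ψ d ≠ 0 then x else y :=
    Measurable.ite mψ measurable_const measurable_const
  have m2 : Measurable fun e : Bool × Choice q a =>
      if e.1 = true ∧ e.2.1 = j then (if ψ e.2.2 ≠ 0 then x else y) else z := by
    refine Measurable.ite ?_ (m1.comp (measurable_snd.comp measurable_snd)) measurable_const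
    exact (measurable_fst (MeasurableSet.of_discrete (s := {true}))).inter
      ((measurable_fst.comp measurable_snd) (MeasurableSet.of_discrete (s := {j})))
  unfold slotLaw
  rw [lintegral_prod _ m2.aemeasurable]
  have hc : ∀ b : Bool, ∫⁻ c, (if b = true ∧ c.1 = j then (if ψ c.2 ≠ 0 then x else y) else z)
      ∂(choiceLaw q a) = if b = true then ENNReal.ofReal (1 / q) * ((x + y) / 2)
        + ENNReal.ofReal (1 - 1 / q) * z else z := by
    intro b
    have m3 := m2.comp (measurable_prodMk_left (x := b))
    have m3' : Measurable fun c : Choice q a =>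
      (if b = true ∧ c.1 = j then (if ψ c.2 ≠ 0 then x else y) else z) := m3
    unfold choiceLaw
    rw [lintegral_prod _ m3'.aemeasurable]
    cases b with
    | false => simp
    | true =>
      have : ∀ i : Fin q, ∫⁻ d, (if true = true ∧ i = j then (if ψ d ≠ 0 then x else y) else z)
        ∂((Measure.infinitePi fun _ : Fin a => uniformLaw (ZMod 2)).prod
        (Measure.infinitePi fun _ : ℕ => uniformLaw (ZMod 2)))
          = if i = j then (x + y) / 2 else z := by
        intro i
        by_cases hi : i = j
        · simp only [hi, and_self, if_true]; exact h
        · simp [hi]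
      rw [lintegral_congr this, lintegral_uniformLaw, Finset.sum_ite, Finset.filter_eq', Finset.filter_ne']
      simp only [Finset.mem_univ, if_true, Finset.sum_const, Finset.card_singleton, one_smul,
        Finset.card_erase_of_mem, Finset.card_univ, Fintype.card_fin, nsmul_eq_mul]
      rw [ENNReal.add_div, ENNReal.ofReal_div_of_pos hq, ENNReal.ofReal_one, ENNReal.ofReal_natCast]
      have h2 : ENNReal.ofReal (1 - 1 / q) = ((q - 1 : ℕ) : ℝ≥0∞) / q := by
        rw [← ENNReal.ofReal_natCast, ← ENNReal.ofReal_natCast q, ← ENNReal.ofReal_div_of_pos hq]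
        congr 1
        rw [Nat.cast_sub (Nat.pos_of_ne_zero (NeZero.ne q))]
        field_simp
        simp
      rw [h2]
      simp only [ENNReal.div_eq_inv_mul]
      ring
  rw [lintegral_congr hc]
  rw [bernoulliMeasure_def, lintegral_add_measure, lintegral_smul_measure, lintegral_smul_measure,
    lintegral_dirac, lintegral_dirac]
  have hp0 : (0 : ℝ) ≤ p := p.2.1
  have hp1 : (p : ℝ) ≤ 1 := p.2.2
  have e1 : ((unitInterval.toNNReal p : NNReal) : ℝ≥0∞) = ENNReal.ofReal (p : ℝ) := by
    rw [ENNReal.ofReal, ENNReal.coe_inj]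
    ext; simp [hp0]
  have e2 : ((unitInterval.toNNReal (unitInterval.symm p) : NNReal) : ℝ≥0∞)
      = ENNReal.ofReal (1 - p : ℝ) := by
    rw [ENNReal.ofReal, ENNReal.coe_inj]
    ext; simp [hp1]
  simp only [if_true, Bool.false_eq_true, if_false, ENNReal.smul_def, smul_eq_mul]
  rw [e1, e2, mul_add, ← mul_assoc, ← mul_assoc, ← ENNReal.ofReal_mul hp0, ← ENNReal.ofReal_mul hp0,
    add_assoc, ← add_mul, ← ENNReal.ofReal_add]
  · congr 3
    · ring
    · ring
  · exact mul_nonneg hp0 (by rw [sub_nonneg, div_le_one hq]; exact hq1)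
  · linarith

end OneTransmission

variable {L q a : ℕ}

/-- Link `i` delivers a packet of chunk `j` in slot `s`. -/
def Active (ω : Sample L q a) (j : Fin q) (s : ℕ) (i : Fin L) : Prop :=
  ω.1 (s, i) = true ∧ (ω.2 (s, i)).1 = j

/-- Link `i` delivers in slot `s` a packet of chunk `j` that `φ` does not annihilate. -/
def Detected (ω : Sample L q a) (j : Fin q) (φ : Module.Dual (ZMod 2) (Fin a → ZMod 2)) (s : ℕ)
    (i : Fin L) : Prop :=
  Active ω j s i ∧ φ (packet ω.2 ω.1 i i.isLt s) ≠ 0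

/-! ### Dependence only on the past and on the same chunk -/

section Congruence

/-- Up to slot `t`, the two samples differ only in transmissions of chunks other than `j`. -/
def AgreeOn (j : Fin q) (t : ℕ) (ω ω' : Sample L q a) : Prop :=
  ∀ s < t, ∀ i : Fin L, (ω.1 (s, i) = ω'.1 (s, i) ∧ ω.2 (s, i) = ω'.2 (s, i)) ∨
    ((ω.2 (s, i)).1 ≠ j ∧ (ω'.2 (s, i)).1 ≠ j)

theorem AgreeOn.symm {j : Fin q} {t : ℕ} {ω ω' : Sample L q a} (h : AgreeOn j t ω ω') :
    AgreeOn j t ω' ω := fun s hs i => by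
  rcases h s hs i with h | h
  · exact Or.inl ⟨h.1.symm, h.2.symm⟩
  · exact Or.inr h.symm

theorem AgreeOn.mono {j : Fin q} {t t' : ℕ} {ω ω' : Sample L q a} (h : AgreeOn j t ω ω')
    (ht : t' ≤ t) : AgreeOn j t' ω ω' := fun s hs i => h s (hs.trans_le ht) i

theorem AgreeOn.active_iff {j : Fin q} {t : ℕ} {ω ω' : Sample L q a} (h : AgreeOn j t ω ω')
    {s : ℕ} (hs : s < t) (i : Fin L) : Active ω j s i ↔ Active ω' j s i := by
  unfold Active
  rcases h s hs i with h | h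
  · rw [h.1, h.2]
  · simp [h.1, h.2]

/-- A node mixes only packets of the chunk it sends, so transmissions of other chunks never enter,
however far downstream. Induction on the node. -/
theorem AgreeOn.packet_eq {j : Fin q} {t : ℕ} {ω ω' : Sample L q a} (h : AgreeOn j t ω ω') :
    ∀ (i : ℕ) (hi : i < L) (s : ℕ), s < t → (ω.2 (s, ⟨i, hi⟩)).1 = j →
      packet ω.2 ω.1 i hi s = packet ω'.2 ω'.1 i hi s
  | 0, hi, s, hs, hj => by
    rcases h s hs ⟨0, hi⟩ with h | h
    · simp only [packet, h.2]
    · exact absurd hj h.1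
  | i + 1, hi, s, hs, hj => by
    rcases h s hs ⟨i + 1, hi⟩ with h0 | h0
    · simp only [packet]
      rw [← h0.2, hj]
      refine Finset.sum_congr rfl fun r hr => ?_
      have hr' : r < t := (Finset.mem_range.1 hr).trans hs
      have hact := h.active_iff hr' ⟨i, Nat.lt_of_succ_lt hi⟩
      unfold Active at hact
      by_cases hA : ω.1 (r, ⟨i, Nat.lt_of_succ_lt hi⟩) = true ∧
          (ω.2 (r, ⟨i, Nat.lt_of_succ_lt hi⟩)).1 = j
      · rw [if_pos hA, if_pos (hact.1 hA), h.packet_eq i (Nat.lt_of_succ_lt hi) r hr' hA.2]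
      · rw [if_neg hA, if_neg (fun h' => hA (hact.2 h'))]
    · exact absurd hj h0.1

theorem AgreeOn.detected_iff {j : Fin q} {t : ℕ} {ω ω' : Sample L q a} (h : AgreeOn j t ω ω')
    (φ : Module.Dual (ZMod 2) (Fin a → ZMod 2)) {s : ℕ} (hs : s < t) (i : Fin L) :
    Detected ω j φ s i ↔ Detected ω' j φ s i := by
  unfold Detected
  rw [← h.active_iff hs i]
  refine and_congr_right fun hA => ?_
  rw [h.packet_eq i i.isLt s hs hA.2]

theorem AgreeOn.sinkVectors_subset {j : Fin q} {t : ℕ} {ω ω' : Sample L q a}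
    (h : AgreeOn j t ω ω') : sinkVectors ω.2 ω.1 t j ⊆ sinkVectors ω'.2 ω'.1 t j := by
  rintro v ⟨s, hs, i, hi, hT, hj, rfl⟩
  have hA := (h.active_iff hs i).1 ⟨hT, hj⟩
  exact ⟨s, hs, i, hi, hA.1, hA.2, h.packet_eq i i.isLt s hs hj⟩

theorem AgreeOn.chunkDecodable_iff {j : Fin q} {t : ℕ} {ω ω' : Sample L q a}
    (h : AgreeOn j t ω ω') : ChunkDecodable ω.2 ω.1 t j ↔ ChunkDecodable ω'.2 ω'.1 t j := by
  unfold ChunkDecodable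
  rw [h.sinkVectors_subset.antisymm h.symm.sinkVectors_subset]

theorem agreeOn_resample (ω : Sample L q a) (j : Fin q) {t : ℕ} {x : ℕ × Fin L} (hx : t ≤ x.1)
    (e : Bool × Choice q a) : AgreeOn j t (resample ω x e) ω := fun s hs i => by
  have : (s, i) ≠ x := by rintro rfl; simp at hx; omega
  simp [resample, Function.update_of_ne this]

theorem agreeOn_resample_of_ne (ω : Sample L q a) {j : Fin q} (t : ℕ) {x : ℕ × Fin L}
    {e : Bool × Choice q a} (h1 : (ω.2 x).1 ≠ j) (h2 : e.2.1 ≠ j) :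
    AgreeOn j t (resample ω x e) ω := fun s _ i => by
  by_cases hx : (s, i) = x
  · subst hx
    right
    simp [resample, h1, h2]
  · simp [resample, Function.update_of_ne hx]

end Congruence

/-! ### A functional travelling down the line -/

section Detection

open Classical in
/-- The number of nodes, after the source, that `φ` detects to hold information about chunk `j`. -/
noncomputable def position (ω : Sample L q a) (j : Fin q)
    (φ : Module.Dual (ZMod 2) (Fin a → ZMod 2)) : ℕ → ℕ
  | 0 => 0
  | t + 1 => position ω j φ t +
      if ∃ i : Fin L, (i : ℕ) = position ω j φ t ∧ Detected ω j φ t i then 1 else 0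

open Classical in
/-- The number of transmissions of chunk `j` received over the link behind the last detected node. -/
noncomputable def coins (ω : Sample L q a) (j : Fin q)
    (φ : Module.Dual (ZMod 2) (Fin a → ZMod 2)) : ℕ → ℕ
  | 0 => 0
  | t + 1 => coins ω j φ t +
      if ∃ i : Fin L, (i : ℕ) = position ω j φ t ∧ Active ω j t i then 1 else 0

open Classical in
/-- The factor of a slot in which link `i` is awaited: `x` if it delivers a detected packet, `y` if
it delivers another packet of the chunk, `z` otherwise. -/
noncomputable def factor (x y z : ℝ≥0∞) (ω : Sample L q a) (j : Fin q)
    (φ : Module.Dual (ZMod 2) (Fin a → ZMod 2)) (t : ℕ) (i : Fin L) : ℝ≥0∞ :=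
  if Active ω j t i then (if φ (packet ω.2 ω.1 i i.isLt t) ≠ 0 then x else y) else z

/-- The product of the factors until the sink is detected. -/
noncomputable def weight (x y z : ℝ≥0∞) (ω : Sample L q a) (j : Fin q)
    (φ : Module.Dual (ZMod 2) (Fin a → ZMod 2)) : ℕ → ℝ≥0∞
  | 0 => 1
  | t + 1 => weight x y z ω j φ t *
      if h : position ω j φ t < L then factor x y z ω j φ t ⟨position ω j φ t, h⟩ else 1

open Classical in
theorem position_succ {ω : Sample L q a} {j : Fin q} {φ : Module.Dual (ZMod 2) (Fin a → ZMod 2)}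
    {t : ℕ} {i : Fin L} (h : position ω j φ t = i) :
    position ω j φ (t + 1) = i + if Detected ω j φ t i then 1 else 0 := by
  rw [position, h]
  congr 1
  by_cases hd : Detected ω j φ t i
  · rw [if_pos hd, if_pos ⟨i, rfl, hd⟩]
  · rw [if_neg hd, if_neg]
    rintro ⟨k, hk, hd'⟩
    exact hd (Fin.ext hk ▸ hd')

open Classical in
theorem coins_succ {ω : Sample L q a} {j : Fin q} {φ : Module.Dual (ZMod 2) (Fin a → ZMod 2)}
    {t : ℕ} {i : Fin L} (h : position ω j φ t = i) :
    coins ω j φ (t + 1) = coins ω j φ t + if Active ω j t i then 1 else 0 := by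
  rw [coins, h]
  congr 1
  by_cases hd : Active ω j t i
  · rw [if_pos hd, if_pos ⟨i, rfl, hd⟩]
  · rw [if_neg hd, if_neg]
    rintro ⟨k, hk, hd'⟩
    exact hd (Fin.ext hk ▸ hd')

theorem weight_succ (x y z : ℝ≥0∞) {ω : Sample L q a} {j : Fin q}
    {φ : Module.Dual (ZMod 2) (Fin a → ZMod 2)}
    {t : ℕ} {i : Fin L} (h : position ω j φ t = i) :
    weight x y z ω j φ (t + 1) = weight x y z ω j φ t * factor x y z ω j φ t i := by
  have hlt : position ω j φ t < L := h ▸ i.isLt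
  have : (⟨position ω j φ t, hlt⟩ : Fin L) = i := Fin.ext h
  rw [weight, dif_pos hlt, this]

theorem position_mono (ω : Sample L q a) (j : Fin q)
    (φ : Module.Dual (ZMod 2) (Fin a → ZMod 2)) : Monotone (position ω j φ) :=
  monotone_nat_of_le_succ fun t => by simp [position]

theorem coins_mono (ω : Sample L q a) (j : Fin q)
    (φ : Module.Dual (ZMod 2) (Fin a → ZMod 2)) : Monotone (coins ω j φ) :=
  monotone_nat_of_le_succ fun t => by simp [coins]

theorem exists_detected_of_lt_position {ω : Sample L q a} {j : Fin q}
    {φ : Module.Dual (ZMod 2) (Fin a → ZMod 2)} {t : ℕ} {i : Fin L}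
    (h : (i : ℕ) < position ω j φ t) : ∃ s < t, Detected ω j φ s i := by
  induction t with
  | zero => simp [position] at h
  | succ t ih =>
    by_cases hi : (i : ℕ) < position ω j φ t
    · obtain ⟨s, hs, h'⟩ := ih hi
      exact ⟨s, hs.trans (Nat.lt_succ_self t), h'⟩
    · rw [position] at h
      split_ifs at h with hd
      · obtain ⟨i', hi', hd⟩ := hd
        have : i' = i := Fin.ext (by omega)
        exact ⟨t, Nat.lt_succ_self t, this ▸ hd⟩
      · omega

/-- A proper subspace lies in the kernel of a nonzero functional. Having killed all that the sink
received, this functional was never detected over the last link. -/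
theorem exists_position_lt_of_not_chunkDecodable (hL : 0 < L) {ω : Sample L q a} {j : Fin q}
    {t : ℕ} (h : ¬ ChunkDecodable ω.2 ω.1 t j) :
    ∃ φ : Module.Dual (ZMod 2) (Fin a → ZMod 2), φ ≠ 0 ∧ position ω j φ t < L := by
  obtain ⟨φ, hφ, hle⟩ := Submodule.exists_le_ker_of_lt_top _ (lt_top_iff_ne_top.2 h)
  refine ⟨φ, hφ, ?_⟩
  by_contra! hp
  obtain ⟨s, hs, ⟨hT, hj⟩, hne⟩ := exists_detected_of_lt_position
    (i := ⟨L - 1, by omega⟩) (ω := ω) (j := j) (φ := φ) (t := t) (by simp; omega)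
  apply hne
  have := hle (Submodule.subset_span ⟨s, hs, ⟨L - 1, by omega⟩, by simp; omega, hT, hj, rfl⟩)
  exact this

theorem AgreeOn.position_eq {j : Fin q} {t : ℕ} {ω ω' : Sample L q a} (h : AgreeOn j t ω ω')
    (φ : Module.Dual (ZMod 2) (Fin a → ZMod 2)) : position ω j φ t = position ω' j φ t := by
  induction t with
  | zero => rfl
  | succ t ih =>
    have ih := ih (h.mono t.le_succ)
    have hd : (∃ i : Fin L, (i : ℕ) = position ω j φ t ∧ Detected ω j φ t i) ↔
        ∃ i : Fin L, (i : ℕ) = position ω' j φ t ∧ Detected ω' j φ t i := by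
      simp only [ih, h.detected_iff φ t.lt_succ_self]
    rw [position, position, ih]
    rw [ih] at hd
    congr 1
    split_ifs with h1 h2 h2
    · rfl
    · exact absurd (hd.1 h1) h2
    · exact absurd (hd.2 h2) h1
    · rfl

theorem AgreeOn.weight_eq {j : Fin q} {t : ℕ} {ω ω' : Sample L q a} (h : AgreeOn j t ω ω')
    (x y z : ℝ≥0∞) (φ : Module.Dual (ZMod 2) (Fin a → ZMod 2)) :
    weight x y z ω j φ t = weight x y z ω' j φ t := by
  induction t with
  | zero => rfl
  | succ t ih =>
    have hf : ∀ i, factor x y z ω j φ t i = factor x y z ω' j φ t i := by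
      intro i
      unfold factor
      by_cases hA : Active ω j t i
      · rw [if_pos hA, if_pos ((h.active_iff t.lt_succ_self i).1 hA),
          h.packet_eq i i.isLt t t.lt_succ_self hA.2]
      · rw [if_neg hA, if_neg fun h' => hA ((h.active_iff t.lt_succ_self i).2 h')]
    simp only [weight, ih (h.mono t.le_succ), (h.mono t.le_succ).position_eq φ, hf]

/-- Every slot before detection at the sink is a head (`l * y`), a tail (`y`) or idle (`z`). The
heads number `position`, heads and tails together `coins`, and `g` counts the idle slots. -/
theorem weight_eq_of_position_lt (l y z : ℝ≥0∞) {ω : Sample L q a} {j : Fin q}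
    {φ : Module.Dual (ZMod 2) (Fin a → ZMod 2)} {t : ℕ} (h : position ω j φ t < L) :
    ∃ g, coins ω j φ t + g = t ∧ weight (l * y) y z ω j φ t
      = l ^ position ω j φ t * y ^ coins ω j φ t * z ^ g := by
  induction t with
  | zero => exact ⟨0, by simp [coins, weight, position]⟩
  | succ t ih =>
    have hlt : position ω j φ t < L := (position_mono ω j φ t.le_succ).trans_lt h
    obtain ⟨g, hg, hw⟩ := ih hlt
    have hi : position ω j φ t = (⟨position ω j φ t, hlt⟩ : Fin L) := rfl
    rw [position_succ hi, coins_succ hi, weight_succ _ _ _ hi, hw]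
    simp only [factor, Detected]
    by_cases hA : Active ω j t ⟨position ω j φ t, hlt⟩
    · by_cases hd : φ (packet ω.2 ω.1 (position ω j φ t) hlt t) ≠ 0
      · refine ⟨g, ?_, ?_⟩
        · simp [hA]; omega
        · simp [hA, hd]; ring
      · refine ⟨g, ?_, ?_⟩
        · simp [hA]; omega
        · simp only [hA, if_true, hd, and_false, if_false, add_zero]; ring
    · refine ⟨g + 1, ?_, ?_⟩
      · simp [hA]; omega
      · simp [hA]; ring

open Classical in
/-- The number of slots in `[s, t)` in which link `i` delivers a packet of chunk `j`. -/
noncomputable def activeCount (ω : Sample L q a) (j : Fin q) (i : Fin L) (s t : ℕ) : ℕ :=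
  ∑ r ∈ Finset.Ico s t, if Active ω j r i then 1 else 0

theorem coins_eq_of_position_eq {ω : Sample L q a} {j : Fin q}
    {φ : Module.Dual (ZMod 2) (Fin a → ZMod 2)} {i : Fin L} {s : ℕ} (hs : position ω j φ s = i) :
    ∀ t, s ≤ t → position ω j φ t = i →
      coins ω j φ t = coins ω j φ s + activeCount ω j i s t := by
  intro t hst
  induction t, hst using Nat.le_induction with
  | base => simp [activeCount]
  | succ t hst ih =>
    intro ht
    have h1 := position_mono ω j φ hst
    have h2 := position_mono ω j φ t.le_succ
    have h3 : position ω j φ t = i := by simp only [Nat.succ_eq_add_one] at h2; omega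
    rw [coins_succ h3, ih h3]
    unfold activeCount
    rw [Finset.sum_Ico_succ_top hst]
    exact add_assoc _ _ _

/-- If every link is active at least `N` times in each of `w` windows, then a functional that has
not reached the sink has seen the coins of all but at most `L` windows. -/
theorem le_coins_of_activeCount {ω : Sample L q a} {j : Fin q}
    {φ : Module.Dual (ZMod 2) (Fin a → ZMod 2)} {w W N : ℕ}
    (hN : ∀ b < w, ∀ i : Fin L, N ≤ activeCount ω j i (b * W) ((b + 1) * W))
    (hlt : position ω j φ (w * W) < L) : w * N ≤ coins ω j φ (w * W) + N * L := by
  -- A window in which the position moves is charged to the last term; otherwise one link is awaited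
  -- throughout the window and supplies `N` coins.
  have key : ∀ b ≤ w, b * N ≤ coins ω j φ (b * W) + N * position ω j φ (b * W) := by
    intro b
    induction b with
    | zero => simp
    | succ b ih =>
      intro hb
      have ih := ih (by omega)
      have hle : b * W ≤ (b + 1) * W := Nat.mul_le_mul_right _ b.le_succ
      have hlt' : position ω j φ ((b + 1) * W) < L :=
        (position_mono ω j φ (Nat.mul_le_mul_right _ hb)).trans_lt hlt
      rcases (position_mono ω j φ hle).eq_or_lt with he | he
      · have := coins_eq_of_position_eq (i := ⟨_, he ▸ hlt'⟩) rfl _ hle he.symm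
        have he' : N * position ω j φ (b * W) = N * position ω j φ ((b + 1) * W) := by rw [he]
        have := hN b hb ⟨_, he ▸ hlt'⟩
        nlinarith
      · have := coins_mono ω j φ hle
        nlinarith
  have := key w le_rfl
  nlinarith

end Detection

/-! ### Measurability -/

section Measurability

theorem measurable_received (x : ℕ × Fin L) : Measurable fun ω : Sample L q a => ω.1 x :=
  (measurable_pi_apply x).comp measurable_fst

theorem measurable_choice (x : ℕ × Fin L) : Measurable fun ω : Sample L q a => ω.2 x :=
  (measurable_pi_apply x).comp measurable_snd

theorem measurable_chunk (x : ℕ × Fin L) : Measurable fun ω : Sample L q a => (ω.2 x).1 :=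
  measurable_fst.comp (measurable_choice x)

theorem measurableSet_active (j : Fin q) (s : ℕ) (i : Fin L) :
    MeasurableSet {ω : Sample L q a | Active ω j s i} :=
  (measurable_received (s, i) (MeasurableSet.of_discrete (s := {true}))).inter
    (measurable_chunk (s, i) (MeasurableSet.of_discrete (s := {j})))

theorem measurable_packet : ∀ (i : ℕ) (hi : i < L) (s : ℕ),
    Measurable fun ω : Sample L q a => packet ω.2 ω.1 i hi s
  | 0, hi, s => by
    simp only [packet]
    exact measurable_fst.comp (measurable_snd.comp (measurable_choice _))
  | i + 1, hi, s => by
    simp only [packet]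
    refine Finset.measurable_fun_sum _ fun r _ => Measurable.ite ?_ ?_ measurable_const
    · exact (measurable_received _ (MeasurableSet.of_discrete (s := {true}))).inter
        (measurableSet_eq_fun (measurable_chunk _) (measurable_chunk _))
    · rw [measurable_pi_iff]
      intro k
      have h1 : Measurable fun ω : Sample L q a => (ω.2 (s, (⟨i + 1, hi⟩ : Fin L))).2.2 r :=
        (measurable_pi_apply r).comp (measurable_snd.comp (measurable_snd.comp (measurable_choice _)))
      have h2 : Measurable fun ω : Sample L q a =>
          packet ω.2 ω.1 i (Nat.lt_of_succ_lt hi) r k :=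
        (measurable_pi_apply k).comp (measurable_packet i (Nat.lt_of_succ_lt hi) r)
      exact (Measurable.of_discrete (f := fun z : ZMod 2 × ZMod 2 => z.1 • z.2)).comp
        (h1.prodMk h2)

theorem measurable_dual_packet (φ : Module.Dual (ZMod 2) (Fin a → ZMod 2)) (s : ℕ) (i : Fin L) :
    Measurable fun ω : Sample L q a => φ (packet ω.2 ω.1 i i.isLt s) :=
  (Measurable.of_discrete (f := fun v : Fin a → ZMod 2 => φ v)).comp (measurable_packet _ _ _)

theorem measurableSet_detected (j : Fin q) (φ : Module.Dual (ZMod 2) (Fin a → ZMod 2)) (s : ℕ)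
    (i : Fin L) : MeasurableSet {ω : Sample L q a | Detected ω j φ s i} :=
  (measurableSet_active j s i).inter
    (measurable_dual_packet φ s i (MeasurableSet.of_discrete (s := {z | z ≠ 0})))

theorem measurable_position (j : Fin q) (φ : Module.Dual (ZMod 2) (Fin a → ZMod 2)) (t : ℕ) :
    Measurable fun ω : Sample L q a => position ω j φ t := by
  induction t with
  | zero => exact measurable_const
  | succ t ih =>
    simp only [position]
    refine ih.add (Measurable.ite ?_ measurable_const measurable_const)
    simp only [Set.ofPred_exists]
    exact MeasurableSet.iUnion fun i => (measurableSet_eq_fun measurable_const ih).inter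
      (measurableSet_detected j φ t i)

theorem measurable_factor (x y z : ℝ≥0∞) (j : Fin q) (φ : Module.Dual (ZMod 2) (Fin a → ZMod 2))
    (t : ℕ) (i : Fin L) : Measurable fun ω : Sample L q a => factor x y z ω j φ t i :=
  Measurable.ite (measurableSet_active j t i) (Measurable.ite
    (measurable_dual_packet φ t i (MeasurableSet.of_discrete (s := {z | z ≠ 0})))
    measurable_const measurable_const) measurable_const

open Classical in
-- Splitting by the awaited link makes the link a constant in each summand, as needed for
-- measurability and for resampling that link.
theorem weight_succ_eq_sum (x y z : ℝ≥0∞) (ω : Sample L q a) (j : Fin q)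
    (φ : Module.Dual (ZMod 2) (Fin a → ZMod 2)) (t : ℕ) :
    weight x y z ω j φ (t + 1) = (if L ≤ position ω j φ t then weight x y z ω j φ t else 0) +
      ∑ i : Fin L, if position ω j φ t = i then
        weight x y z ω j φ t * factor x y z ω j φ t i else 0 := by
  by_cases h : position ω j φ t < L
  · rw [weight_succ x y z (i := ⟨_, h⟩) rfl, if_neg (not_le.2 h), zero_add,
      Finset.sum_eq_single (⟨_, h⟩ : Fin L)]
    · simp
    · intro i _ hi
      rw [if_neg]
      exact fun h' => hi (Fin.ext h'.symm)
    · simp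
  · rw [weight, dif_neg h, if_pos (not_lt.1 h), mul_one, Finset.sum_eq_zero, add_zero]
    intro i _
    rw [if_neg]
    exact fun h' => h (h' ▸ i.isLt)

theorem measurable_weight (x y z : ℝ≥0∞) (j : Fin q)
    (φ : Module.Dual (ZMod 2) (Fin a → ZMod 2)) (t : ℕ) :
    Measurable fun ω : Sample L q a => weight x y z ω j φ t := by
  classical
  induction t with
  | zero => exact measurable_const
  | succ t ih =>
    simp only [weight_succ_eq_sum]
    refine (Measurable.ite (measurableSet_le measurable_const (measurable_position j φ t)) ih
      measurable_const).add (Finset.measurable_fun_sum _ fun i _ => Measurable.ite ?_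
        (ih.mul (measurable_factor x y z j φ t i)) measurable_const)
    exact measurableSet_eq_fun (measurable_position j φ t) measurable_const

theorem measurable_activeCount (j : Fin q) (i : Fin L) (s t : ℕ) :
    Measurable fun ω : Sample L q a => activeCount ω j i s t :=
  Finset.measurable_fun_sum _ fun r _ =>
    Measurable.ite (measurableSet_active j r i) measurable_const measurable_const

theorem measurableSet_chunkDecodable (t : ℕ) (j : Fin q) :
    MeasurableSet {ω : Sample L q a | ChunkDecodable ω.2 ω.1 t j} := by
  have hv : ∀ v : Fin a → ZMod 2, MeasurableSet {ω : Sample L q a | v ∈ sinkVectors ω.2 ω.1 t j} := by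
    intro v
    have : {ω : Sample L q a | v ∈ sinkVectors ω.2 ω.1 t j} =
        ⋃ s : Fin t, ⋃ i : Fin L, {ω | (i : ℕ) + 1 = L ∧ Active ω j s i ∧
          v = packet ω.2 ω.1 i i.isLt s} := by
      ext ω
      simp only [sinkVectors, Set.mem_ofPred_eq, Set.mem_iUnion, Active]
      constructor
      · rintro ⟨s, hs, i, h1, h2, h3, h4⟩
        exact ⟨⟨s, hs⟩, i, h1, ⟨h2, h3⟩, h4⟩
      · rintro ⟨s, i, h1, ⟨h2, h3⟩, h4⟩
        exact ⟨s, s.isLt, i, h1, h2, h3, h4⟩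
    rw [this]
    refine MeasurableSet.iUnion fun s => MeasurableSet.iUnion fun i =>
      (MeasurableSet.const _).inter ((measurableSet_active j s i).inter ?_)
    exact measurableSet_eq_fun measurable_const (measurable_packet _ _ _)
  -- There are finitely many sets `V` of vectors, so one may split according to the exact set
  -- received.
  have h2 : {ω : Sample L q a | ChunkDecodable ω.2 ω.1 t j} =
      ⋃ V ∈ {V : Set (Fin a → ZMod 2) | Submodule.span (ZMod 2) V = ⊤},
        ⋂ v, {ω | v ∈ sinkVectors ω.2 ω.1 t j ↔ v ∈ V} := by
    ext ω
    simp only [Set.mem_ofPred_eq, Set.mem_iUnion, Set.mem_iInter, exists_prop]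
    constructor
    · intro h
      exact ⟨_, h, fun v => Iff.rfl⟩
    · rintro ⟨V, hV, h⟩
      unfold ChunkDecodable
      rw [Set.ext h]; exact hV
  rw [h2]
  exact MeasurableSet.biUnion (Set.to_countable _) fun V _ => MeasurableSet.iInter fun v =>
    (hv v).iff (MeasurableSet.const _)

end Measurability

/-! ### The supermartingale and the generating function of deliveries -/

section Expectation

variable [NeZero q]

open Classical in
-- Given a delivery, detection is a fair coin. At the source, `φ` is nonzero on some basis vector;
-- at an interior awaited node, `φ` is nonzero on a packet already received. The fresh uniform
-- coefficient of that vector flips the value of `φ`.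
theorem lintegral_factor_resample (p : Fin L → unitInterval) (x y z : ℝ≥0∞) (ω : Sample L q a)
    (j : Fin q) {φ : Module.Dual (ZMod 2) (Fin a → ZMod 2)} (hφ : φ ≠ 0) {t : ℕ} {i : Fin L}
    (hp : position ω j φ t = i) :
    ∫⁻ e, factor x y z (resample ω (t, i) e) j φ t i ∂(slotLaw (p i) q a)
      = ENNReal.ofReal (p i / q) * ((x + y) / 2) + ENNReal.ofReal (1 - p i / q) * z := by
  obtain ⟨ψ, hψm, hψ, hint⟩ : ∃ ψ : (Fin a → ZMod 2) × (ℕ → ZMod 2) → ZMod 2, Measurable ψ ∧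
      (∀ e : Bool × Choice q a, e.2.1 = j →
        φ (packet (resample ω (t, i) e).2 (resample ω (t, i) e).1 i i.isLt t) = ψ e.2.2) ∧
      ∫⁻ d, (if ψ d ≠ 0 then x else y)
        ∂((Measure.infinitePi fun _ : Fin a => uniformLaw (ZMod 2)).prod
          (Measure.infinitePi fun _ : ℕ => uniformLaw (ZMod 2))) = (x + y) / 2 := by
    obtain ⟨i, hi⟩ := i
    cases i with
    | zero =>
      have hm : Measurable fun v : Fin a → ZMod 2 => φ v := Measurable.of_discrete
      refine ⟨fun d => φ d.1, hm.comp measurable_fst, fun e _ => by simp [packet, resample], ?_⟩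
      have hmi : Measurable fun v : Fin a → ZMod 2 => if φ v ≠ 0 then x else y :=
        Measurable.of_discrete
      have hmi' : Measurable fun d : (Fin a → ZMod 2) × (ℕ → ZMod 2) =>
          if φ d.1 ≠ 0 then x else y := hmi.comp measurable_fst
      rw [lintegral_prod _ hmi'.aemeasurable]
      refine (lintegral_congr (g := fun v => if φ v ≠ 0 then x else y) fun v => ?_).trans ?_
      · change ∫⁻ _ : ℕ → ZMod 2, (if φ v ≠ 0 then x else y)
          ∂(Measure.infinitePi fun _ : ℕ => uniformLaw (ZMod 2)) = _
        rw [lintegral_const, measure_univ, mul_one]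
      obtain ⟨k, hk⟩ : ∃ k, φ (Pi.single k 1) ≠ 0 := by
        by_contra! h
        exact hφ (LinearMap.pi_ext' fun k => LinearMap.ext_ring (by simpa using h k))
      have hk1 : φ (Pi.single k 1) = 1 := by
        revert hk; generalize φ (Pi.single k 1) = z; revert z; decide
      refine lintegral_uniform_bit (fun v => φ v) hm k (fun c e => ?_) x y
      have : Function.update c k e = Function.update c k 0 + e • Pi.single k (1 : ZMod 2) := by
        ext l
        by_cases hl : l = k
        · subst hl; simp
        · simp [Function.update_of_ne hl, Pi.single_eq_of_ne hl]
      rw [this, map_add, map_smul, hk1, smul_eq_mul, mul_one]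
    | succ i =>
      have hi' := Nat.lt_of_succ_lt hi
      obtain ⟨s, hs, hA, hne⟩ := exists_detected_of_lt_position
        (i := ⟨i, hi'⟩) (ω := ω) (j := j) (φ := φ) (t := t) (by simp [hp])
      have hs1 : φ (packet ω.2 ω.1 i hi' s) = 1 := by
        revert hne; simp only; generalize φ _ = z; revert z; decide
      -- The value of `φ` on the new packet as a function of the fresh coefficients, with the past
      -- frozen; coefficient `s` flips it.
      let g : (ℕ → ZMod 2) → ZMod 2 := fun c => ∑ r ∈ Finset.range t,
        if Active ω j r ⟨i, hi'⟩ then c r * φ (packet ω.2 ω.1 i hi' r) else 0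
      have hg : Measurable g := by
        refine Finset.measurable_fun_sum _ fun r _ => ?_
        by_cases h : Active ω j r ⟨i, hi'⟩
        · simp only [if_pos h]
          exact (Measurable.of_discrete (f := fun z : ZMod 2 => z * _)).comp
            (measurable_pi_apply r)
        · simp only [if_neg h]; exact measurable_const
      have hgi : Measurable fun c => if g c ≠ 0 then x else y :=
        (Measurable.of_discrete (f := fun z : ZMod 2 => if z ≠ 0 then x else y)).comp hg
      refine ⟨fun d => g d.2, hg.comp measurable_snd, fun e he => ?_, ?_⟩
      · have hag := agreeOn_resample ω j (t := t) (x := (t, ⟨i + 1, hi⟩)) le_rfl e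
        have hc : (resample ω (t, ⟨i + 1, hi⟩) e).2 (t, ⟨i + 1, hi⟩) = e.2 := by simp [resample]
        simp only [packet, hc, he, map_sum, g]
        refine Finset.sum_congr rfl fun r hr => ?_
        have hr := Finset.mem_range.1 hr
        have hact := hag.active_iff hr ⟨i, hi'⟩
        by_cases h : Active ω j r ⟨i, hi'⟩
        · have h' := hact.2 h
          rw [if_pos h, if_pos (And.intro h'.1 h'.2), map_smul, smul_eq_mul, hag.packet_eq i hi' r hr h'.2]
        · rw [if_neg h, if_neg (show ¬(_ ∧ _) from fun h' => h (hact.1 h')), map_zero]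
      · have hgi' : Measurable fun d : (Fin a → ZMod 2) × (ℕ → ZMod 2) =>
            if g d.2 ≠ 0 then x else y := hgi.comp measurable_snd
        rw [lintegral_prod _ hgi'.aemeasurable]
        change ∫⁻ _ : Fin a → ZMod 2, (∫⁻ c, (if g c ≠ 0 then x else y)
          ∂(Measure.infinitePi fun _ : ℕ => uniformLaw (ZMod 2)))
          ∂(Measure.infinitePi fun _ : Fin a => uniformLaw (ZMod 2)) = _
        rw [lintegral_const, measure_univ, mul_one]
        refine lintegral_uniform_bit g hg s (fun c e => ?_) x y
        simp only [g]
        rw [← Finset.add_sum_erase _ _ (Finset.mem_range.2 hs),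
          ← Finset.add_sum_erase _ _ (Finset.mem_range.2 hs), if_pos hA]
        have : ∀ e', ∑ r ∈ (Finset.range t).erase s, (if Active ω j r ⟨i, hi'⟩ then
              Function.update c s e' r * φ (packet ω.2 ω.1 i hi' r) else 0)
            = ∑ r ∈ (Finset.range t).erase s, if Active ω j r ⟨i, hi'⟩ then
              c r * φ (packet ω.2 ω.1 i hi' r) else 0 := by
          intro e'
          refine Finset.sum_congr rfl fun r hr => ?_
          rw [Function.update_of_ne (Finset.ne_of_mem_erase hr)]
        rw [this, this, hs1]
        simp [add_comm]
  rw [← lintegral_slotLaw (p i) j ψ hψm x y z hint]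
  refine lintegral_congr fun e => ?_
  have hA : Active (resample ω (t, i) e) j t i ↔ e.1 = true ∧ e.2.1 = j := by
    simp [Active, resample]
  unfold factor
  by_cases h : e.1 = true ∧ e.2.1 = j
  · rw [if_pos h, if_pos (hA.2 h), hψ e h.2]
  · rw [if_neg h, if_neg (fun h' => h (hA.1 h'))]

open Classical in
-- Supermartingale property: position and weight at time `t` ignore slot `t`, so averaging that slot
-- multiplies the weight by the left side of `hxyz`.
theorem lintegral_weight_le_one (p : Fin L → unitInterval) {x y z : ℝ≥0∞}
    (hxyz : ∀ i, ENNReal.ofReal (p i / q) * ((x + y) / 2) + ENNReal.ofReal (1 - p i / q) * z ≤ 1)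
    (j : Fin q) {φ : Module.Dual (ZMod 2) (Fin a → ZMod 2)} (hφ : φ ≠ 0) (t : ℕ) :
    ∫⁻ ω, weight x y z ω j φ t ∂(sampleLaw p q a) ≤ 1 := by
  induction t with
  | zero => simp [weight]
  | succ t ih =>
    refine le_trans ?_ ih
    have mp := fun i : Fin L => measurableSet_eq_fun (measurable_position (L := L) (a := a) j φ t)
      (measurable_const (a := (i : ℕ)))
    have mL := measurableSet_le (measurable_const (a := L)) (measurable_position (L := L) j φ t)
    have mw := measurable_weight (L := L) x y z j φ t
    have m1 : Measurable fun ω : Sample L q a =>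
        if L ≤ position ω j φ t then weight x y z ω j φ t else 0 :=
      Measurable.ite mL mw measurable_const
    have m2 : ∀ i : Fin L, Measurable fun ω : Sample L q a =>
        if position ω j φ t = i then weight x y z ω j φ t * factor x y z ω j φ t i else 0 :=
      fun i => Measurable.ite (mp i) (mw.mul (measurable_factor x y z j φ t i)) measurable_const
    have m3 : ∀ i : Fin L, Measurable fun ω : Sample L q a =>
        if position ω j φ t = i then weight x y z ω j φ t else 0 :=
      fun i => Measurable.ite (mp i) mw measurable_const
    have hstep : ∀ i : Fin L,
        ∫⁻ ω, (if position ω j φ t = i then weight x y z ω j φ t * factor x y z ω j φ t i else 0)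
          ∂(sampleLaw p q a)
        ≤ ∫⁻ ω, (if position ω j φ t = i then weight x y z ω j φ t else 0) ∂(sampleLaw p q a) := by
      intro i
      rw [← lintegral_resample p (t, i) (m2 i)]
      refine lintegral_mono fun ω => ?_
      have hag := fun e => agreeOn_resample ω j (t := t) (x := (t, i)) le_rfl e
      simp only [fun e => (hag e).position_eq φ, fun e => (hag e).weight_eq x y z φ]
      by_cases h : position ω j φ t = i
      · simp only [if_pos h]
        have hmf : Measurable fun e => factor x y z (resample ω (t, i) e) j φ t i :=
          (measurable_factor x y z j φ t i).comp
            ((measurable_resample (t, i)).comp measurable_prodMk_left)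
        rw [lintegral_const_mul _ hmf, lintegral_factor_resample p x y z ω j hφ h]
        exact mul_le_of_le_one_right' (hxyz i)
      · simp [h]
    simp only [weight_succ_eq_sum]
    rw [lintegral_add_left m1, lintegral_finsetSum _ fun i _ => m2 i]
    refine (add_le_add_right (Finset.sum_le_sum fun i _ => hstep i) _).trans ?_
    rw [← lintegral_finsetSum _ fun i _ => m3 i, ← lintegral_add_left m1]
    refine lintegral_mono fun ω => ?_
    by_cases h : position ω j φ t < L
    · simp only [if_neg (not_le.2 h), zero_add]
      rw [Finset.sum_eq_single (⟨_, h⟩ : Fin L)]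
      · simp
      · intro i _ hi
        rw [if_neg]
        exact fun h' => hi (Fin.ext h'.symm)
      · simp
    · simp only [if_pos (not_lt.1 h)]
      rw [Finset.sum_eq_zero, add_zero]
      intro i _
      rw [if_neg]
      exact fun h' => h (h' ▸ i.isLt)

open Classical in
/-- The generating function of the number of deliveries over a link in a window. -/
theorem lintegral_pow_activeCount (p : Fin L → unitInterval) (j : Fin q) (i : Fin L) (s : ℕ)
    (θ : ℝ≥0∞) {t : ℕ} (hst : s ≤ t) :
    ∫⁻ ω, θ ^ activeCount ω j i s t ∂(sampleLaw p q a)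
      = (ENNReal.ofReal (p i / q) * θ + ENNReal.ofReal (1 - p i / q)) ^ (t - s) := by
  induction t, hst using Nat.le_induction with
  | base => simp [activeCount]
  | succ t hst ih =>
    have hm : ∀ t, Measurable fun ω : Sample L q a => θ ^ activeCount ω j i s t := fun t =>
      (Measurable.of_discrete (f := fun n : ℕ => θ ^ n)).comp (measurable_activeCount j i s t)
    have hstep : ∀ ω : Sample L q a,
        ∫⁻ e, θ ^ activeCount (resample ω (t, i) e) j i s (t + 1) ∂(slotLaw (p i) q a)
          = (ENNReal.ofReal (p i / q) * θ + ENNReal.ofReal (1 - p i / q)) *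
            θ ^ activeCount ω j i s t := by
      intro ω
      -- The trivially true test `1 ≠ 0` casts the factor in the shape of `lintegral_slotLaw`, with
      -- `x = y = θ`.
      have h1 : ∀ e : Bool × Choice q a, θ ^ activeCount (resample ω (t, i) e) j i s (t + 1)
          = θ ^ activeCount ω j i s t * (if e.1 = true ∧ e.2.1 = j then
            (if (1 : ZMod 2) ≠ 0 then θ else θ) else 1) := by
        intro e
        have hag := agreeOn_resample ω j (t := t) (x := (t, i)) le_rfl e
        have hA : Active (resample ω (t, i) e) j t i ↔ e.1 = true ∧ e.2.1 = j := by
          simp [Active, resample]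
        have h2 : activeCount (resample ω (t, i) e) j i s t = activeCount ω j i s t := by
          refine Finset.sum_congr rfl fun r hr => ?_
          simp only [hag.active_iff (Finset.mem_Ico.1 hr).2 i]
        have h3 : activeCount (resample ω (t, i) e) j i s (t + 1) = activeCount ω j i s t +
            if Active (resample ω (t, i) e) j t i then 1 else 0 := by
          rw [← h2]
          unfold activeCount
          rw [Finset.sum_Ico_succ_top hst]
        rw [h3, pow_add]
        by_cases h : e.1 = true ∧ e.2.1 = j
        · rw [if_pos h, if_pos (hA.2 h)]; simp
        · rw [if_neg h, if_neg (fun h' => h (hA.1 h'))]; simp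
      simp only [h1]
      have := lintegral_slotLaw (a := a) (p i) j (fun _ => 1) measurable_const θ θ 1 (by
        simp [ENNReal.add_div, ENNReal.add_halves])
      have hmm : Measurable fun e : Bool × Choice q a => (if e.1 = true ∧ e.2.1 = j then
            (if (1 : ZMod 2) ≠ 0 then θ else θ) else 1) :=
        Measurable.ite ((measurable_fst (MeasurableSet.of_discrete (s := {true}))).inter
          ((measurable_fst.comp measurable_snd) (MeasurableSet.of_discrete (s := {j}))))
          measurable_const measurable_const
      rw [lintegral_const_mul _ hmm, this, ENNReal.add_div, ENNReal.add_halves, mul_one, mul_comm]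
    rw [← lintegral_resample p (t, i) (hm (t + 1))]
    simp only [hstep]
    rw [lintegral_const_mul _ (hm t), ih, Nat.succ_sub hst, pow_succ']

end Expectation

/-! ### Failure probability of one chunk -/

section FailureProbability

variable [NeZero q]

theorem ofReal_step {u x y z : ℝ} (hu0 : 0 ≤ u) (hu1 : u ≤ 1) (hx : 0 ≤ x) (hy : 0 ≤ y)
    (hz : 0 ≤ z) :
    ENNReal.ofReal u * ((ENNReal.ofReal x + ENNReal.ofReal y) / 2)
      + ENNReal.ofReal (1 - u) * ENNReal.ofReal z
      = ENNReal.ofReal (u * ((x + y) / 2) + (1 - u) * z) := by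
  have h2 : (2 : ℝ≥0∞) = ENNReal.ofReal 2 := by simp
  have hu : 0 ≤ 1 - u := by linarith
  rw [h2, ← ENNReal.ofReal_add hx hy, ← ENNReal.ofReal_div_of_pos (by norm_num),
    ← ENNReal.ofReal_mul hu0, ← ENNReal.ofReal_mul hu, ← ENNReal.ofReal_add (by positivity)
      (by positivity)]

theorem div_mem_unit (p : unitInterval) : 0 ≤ (p / q : ℝ) ∧ (p / q : ℝ) ≤ 1 := by
  have hq : (1 : ℝ) ≤ q := by exact_mod_cast Nat.pos_of_ne_zero (NeZero.ne q)
  have hp0 : (0 : ℝ) ≤ p := p.2.1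
  have hp1 : (p : ℝ) ≤ 1 := p.2.2
  exact ⟨by positivity, by rw [div_le_one (by linarith)]; linarith⟩

/-- Markov's inequality for `weight`. -/
theorem sampleLaw_le_inv_of_le_weight (p : Fin L → unitInterval) {x y z : ℝ} (hx : 0 ≤ x)
    (hy : 0 ≤ y) (hz : 0 ≤ z)
    (hxyz : ∀ i, (p i / q : ℝ) * ((x + y) / 2) + (1 - p i / q) * z ≤ 1)
    (j : Fin q) {φ : Module.Dual (ZMod 2) (Fin a → ZMod 2)} (hφ : φ ≠ 0) (t : ℕ)
    {S : Set (Sample L q a)} {c : ℝ} (hc : 0 < c)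
    (hS : ∀ ω ∈ S, ENNReal.ofReal c ≤
      weight (ENNReal.ofReal x) (ENNReal.ofReal y) (ENNReal.ofReal z) ω j φ t) :
    sampleLaw p q a S ≤ ENNReal.ofReal c⁻¹ := by
  have h1 := lintegral_weight_le_one (q := q) p (x := ENNReal.ofReal x) (y := ENNReal.ofReal y)
    (z := ENNReal.ofReal z) (fun i => by
      rw [ofReal_step (div_mem_unit (p i)).1 (div_mem_unit (p i)).2 hx hy hz]
      exact ENNReal.ofReal_le_one.2 (hxyz i)) j hφ t
  have hc0 : ENNReal.ofReal c ≠ 0 := by simpa using hc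
  have h2 := mul_meas_ge_le_lintegral (μ := sampleLaw p q a) (measurable_weight
    (ENNReal.ofReal x) (ENNReal.ofReal y) (ENNReal.ofReal z) j φ t) (ENNReal.ofReal c)
  rw [ENNReal.ofReal_inv_of_pos hc, ← one_div, ENNReal.le_div_iff_mul_le (Or.inl hc0)
    (Or.inl ENNReal.ofReal_ne_top), mul_comm]
  exact (mul_le_mul_right (measure_mono hS) _).trans (h2.trans h1)

/-- The union bound over the functionals that could witness that a chunk is not decodable. -/
theorem measure_not_chunkDecodable_inter_le (hL : 0 < L) (p : Fin L → unitInterval) (j : Fin q)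
    (t : ℕ) (G : Set (Sample L q a)) {b : ℝ}
    (h : ∀ φ : Module.Dual (ZMod 2) (Fin a → ZMod 2), φ ≠ 0 →
      sampleLaw p q a {ω | ω ∈ G ∧ position ω j φ t < L} ≤ ENNReal.ofReal b) :
    sampleLaw p q a {ω | ω ∈ G ∧ ¬ ChunkDecodable ω.2 ω.1 t j} ≤ ENNReal.ofReal (2 ^ a * b) := by
  classical
  let E := (Pi.basisFun (ZMod 2) (Fin a)).toDualEquiv
  have hsub : {ω : Sample L q a | ω ∈ G ∧ ¬ ChunkDecodable ω.2 ω.1 t j} ⊆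
      ⋃ v ∈ (Finset.univ.filter fun v : Fin a → ZMod 2 => v ≠ 0),
        {ω | ω ∈ G ∧ position ω j (E v) t < L} := by
    rintro ω ⟨hG, hω⟩
    obtain ⟨φ, hφ, hlt⟩ := exists_position_lt_of_not_chunkDecodable hL hω
    simp only [Set.mem_iUnion, Finset.mem_filter, Finset.mem_univ, true_and]
    refine ⟨E.symm φ, by simpa using hφ, hG, ?_⟩
    rw [LinearEquiv.apply_symm_apply]; exact hlt
  refine (measure_mono hsub).trans ((measure_biUnion_finset_le _ _).trans ?_)
  refine (Finset.sum_le_sum (g := fun _ => ENNReal.ofReal b) fun v hv => h (E v) (by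
    simpa using hv)).trans ?_
  rw [Finset.sum_const, nsmul_eq_mul, ENNReal.ofReal_mul (by positivity)]
  gcongr
  rw [← ENNReal.ofReal_natCast]
  refine ENNReal.ofReal_le_ofReal ?_
  have : (Finset.univ.filter fun v : Fin a → ZMod 2 => v ≠ 0).card ≤ 2 ^ a :=
    (Finset.card_filter_le _ _).trans (by simp)
  exact_mod_cast this

/-- A crude bound valid at all times, used for the far tail of the delay. Every slot gains `g⁻¹` and
every head loses a factor 2; the mean factor is `(1 - p i / (4 q)) g⁻¹ ≤ 1`, and an undetected sink
means fewer than `L` heads. -/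
theorem measure_not_chunkDecodable_le (hL : 0 < L) (p : Fin L → unitInterval) {pm : ℝ}
    (hp : ∀ i, pm ≤ p i) (j : Fin q) (t : ℕ) :
    sampleLaw p q a {ω | ¬ ChunkDecodable ω.2 ω.1 t j}
      ≤ ENNReal.ofReal (2 ^ a * (2 ^ L * Real.exp (-(pm / (4 * q)) * t))) := by
  have hq : (1 : ℝ) ≤ q := by exact_mod_cast Nat.pos_of_ne_zero (NeZero.ne q)
  have hp1 : pm ≤ 1 := (hp ⟨0, hL⟩).trans (p _).2.2
  set g : ℝ := 1 - pm / (4 * q) with hg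
  have hgq : pm / (4 * q) ≤ 1 / 4 := by
    rw [div_le_div_iff₀ (by linarith) (by norm_num)]; nlinarith
  have hg0 : 0 < g := by linarith
  have hset : {ω : Sample L q a | ¬ ChunkDecodable ω.2 ω.1 t j} =
      {ω | ω ∈ (Set.univ : Set (Sample L q a)) ∧ ¬ ChunkDecodable ω.2 ω.1 t j} := by simp
  rw [hset]
  refine measure_not_chunkDecodable_inter_le hL p j t _ fun φ hφ => ?_
  have hc : 0 < (1 / 2 : ℝ) ^ L * g⁻¹ ^ t := by positivity
  refine (sampleLaw_le_inv_of_le_weight p (x := 1 / 2 * g⁻¹) (y := g⁻¹) (z := g⁻¹)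
    (by positivity) (by positivity) (by positivity) (fun i => ?_) j hφ t hc ?_).trans ?_
  · have : (p i / q : ℝ) * ((1 / 2 * g⁻¹ + g⁻¹) / 2) + (1 - p i / q) * g⁻¹
        = (1 - p i / (4 * q)) * g⁻¹ := by field_simp; ring
    rw [this, ← div_eq_mul_inv, div_le_one hg0, hg]
    have := hp i
    gcongr
  · rintro ω ⟨-, hω⟩
    obtain ⟨n, hn, hw⟩ := weight_eq_of_position_lt (ENNReal.ofReal (1 / 2)) (ENNReal.ofReal g⁻¹)
      (ENNReal.ofReal g⁻¹) hω
    rw [ENNReal.ofReal_mul (p := 1 / 2) (by norm_num), hw, mul_assoc, ← pow_add, hn,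
      ENNReal.ofReal_mul (p := (1 / 2) ^ L) (by positivity), ENNReal.ofReal_pow (by norm_num),
      ENNReal.ofReal_pow (by positivity)]
    gcongr 1
    exact pow_le_pow_right_of_le_one' (ENNReal.ofReal_le_one.2 (by norm_num)) hω.le
  · refine ENNReal.ofReal_le_ofReal ?_
    rw [mul_inv, one_div, inv_pow, inv_inv, inv_pow, inv_inv]
    gcongr
    rw [mul_comm, Real.exp_nat_mul]
    gcongr
    have := Real.add_one_le_exp (-(pm / (4 * q)))
    linarith

/-- Chernoff's lower tail bound, with `θ = exp (-δ / 2)` and `1 - θ ≥ δ / 2 - δ ^ 2 / 4`. -/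
theorem measure_activeCount_le (p : Fin L → unitInterval) {pm : ℝ}
    (hpm : 0 < pm) (hp : ∀ i, pm ≤ p i) (j : Fin q) (i : Fin L) (s W N : ℕ) {δ : ℝ}
    (hδ : 0 < δ) (hδ1 : δ ≤ 1) (hN : (N : ℝ) ≤ (1 - δ) * (pm * W / q)) :
    sampleLaw p q a {ω | activeCount ω j i s (s + W) < N}
      ≤ ENNReal.ofReal (Real.exp (-(δ ^ 2 * (pm * W / q) / 4))) := by
  have hq : (1 : ℝ) ≤ q := by exact_mod_cast Nat.pos_of_ne_zero (NeZero.ne q)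
  set θ : ℝ := Real.exp (-(δ / 2)) with hθ
  have hθ0 : 0 < θ := Real.exp_pos _
  have hθ1 : θ ≤ 1 := Real.exp_le_one_iff.2 (by linarith)
  have hm : Measurable fun ω : Sample L q a => ENNReal.ofReal θ ^ activeCount ω j i s (s + W) :=
    (Measurable.of_discrete (f := fun n : ℕ => ENNReal.ofReal θ ^ n)).comp
      (measurable_activeCount j i s _)
  have h1 := mul_meas_ge_le_lintegral (μ := sampleLaw p q a) hm (ENNReal.ofReal θ ^ N)
  rw [lintegral_pow_activeCount p j i s _ (Nat.le_add_right s W), Nat.add_sub_cancel_left] at h1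
  have hu := div_mem_unit (q := q) (p i)
  have hu1 : 0 ≤ (1 - p i / q : ℝ) := by linarith
  have hbase0 : 0 ≤ (p i / q * θ + (1 - p i / q) : ℝ) :=
    add_nonneg (mul_nonneg hu.1 hθ0.le) hu1
  rw [← ENNReal.ofReal_mul hu.1, ← ENNReal.ofReal_add (mul_nonneg hu.1 hθ0.le) hu1,
    ← ENNReal.ofReal_pow hθ0.le, ← ENNReal.ofReal_pow hbase0] at h1
  have hsub : {ω : Sample L q a | activeCount ω j i s (s + W) < N} ⊆
      {ω | ENNReal.ofReal (θ ^ N) ≤ ENNReal.ofReal θ ^ activeCount ω j i s (s + W)} := by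
    intro ω hω
    rw [Set.mem_ofPred_eq, ENNReal.ofReal_pow hθ0.le]
    exact pow_le_pow_right_of_le_one' (ENNReal.ofReal_le_one.2 hθ1) (le_of_lt hω)
  have hθN : ENNReal.ofReal (θ ^ N) ≠ 0 := by simpa using pow_pos hθ0 N
  have h2 : sampleLaw p q a {ω | activeCount ω j i s (s + W) < N} ≤
      ENNReal.ofReal ((p i / q * θ + (1 - p i / q)) ^ W) / ENNReal.ofReal (θ ^ N) := by
    rw [ENNReal.le_div_iff_mul_le (Or.inl hθN) (Or.inl ENNReal.ofReal_ne_top), mul_comm]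
    exact (mul_le_mul_right (measure_mono hsub) _).trans h1
  refine h2.trans ?_
  rw [← ENNReal.ofReal_div_of_pos (by positivity)]
  refine ENNReal.ofReal_le_ofReal ?_
  have hbase : (p i / q * θ + (1 - p i / q) : ℝ) ≤ Real.exp (-((1 - θ) * (pm / q))) := by
    have h3 := Real.add_one_le_exp (-((1 - θ) * (pm / q)))
    have h4 : (1 - θ) * (pm / q) ≤ (1 - θ) * (p i / q) := by
      have := hp i
      have : 0 ≤ 1 - θ := by linarith
      gcongr
    linarith
  have hpow : (p i / q * θ + (1 - p i / q) : ℝ) ^ W ≤ Real.exp (W * -((1 - θ) * (pm / q))) := by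
    rw [Real.exp_nat_mul]
    exact pow_le_pow_left₀ hbase0 hbase W
  have hθNe : θ ^ N = Real.exp (N * -(δ / 2)) := by rw [Real.exp_nat_mul]
  rw [div_le_iff₀ (by positivity), hθNe, ← Real.exp_add]
  refine hpow.trans (Real.exp_le_exp.2 ?_)
  have hb := Real.abs_exp_sub_one_sub_id_le (x := -(δ / 2)) (by rw [abs_le]; constructor <;> linarith)
  have hb' : δ / 2 - (δ / 2) ^ 2 ≤ 1 - θ := by
    have := (abs_le.1 hb).2
    rw [← hθ] at this
    nlinarith
  have hμ : pm * W / q = W * (pm / q) := by ring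
  rw [hμ] at hN ⊢
  have h0 : 0 ≤ (W : ℝ) * (pm / q) := by positivity
  nlinarith [mul_le_mul_of_nonneg_right hb' h0]

/-- The probability that a chunk is not decodable after `w` windows of `W` slots. -/
theorem measure_not_chunkDecodable_windows_le (hL : 0 < L) (p : Fin L → unitInterval) {pm : ℝ}
    (hpm : 0 < pm) (hp : ∀ i, pm ≤ p i) (j : Fin q) {w W N : ℕ} {δ l : ℝ}
    (hδ : 0 < δ) (hδ1 : δ ≤ 1) (hN : (N : ℝ) ≤ (1 - δ) * (pm * W / q)) (hl : 0 < l) (hl1 : l ≤ 1) :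
    sampleLaw p q a {ω | ¬ ChunkDecodable ω.2 ω.1 (w * W) j}
      ≤ ENNReal.ofReal (w * L * Real.exp (-(δ ^ 2 * (pm * W / q) / 4)) +
        2 ^ a * (l⁻¹ ^ L * ((1 + l) / 2) ^ (N * (w - L)))) := by
  let G : Set (Sample L q a) :=
    {ω | ∀ b < w, ∀ i : Fin L, N ≤ activeCount ω j i (b * W) ((b + 1) * W)}
  have hsub : {ω : Sample L q a | ¬ ChunkDecodable ω.2 ω.1 (w * W) j} ⊆
      (⋃ b ∈ Finset.range w, ⋃ i ∈ (Finset.univ : Finset (Fin L)),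
        {ω | activeCount ω j i (b * W) (b * W + W) < N}) ∪
      {ω | ω ∈ G ∧ ¬ ChunkDecodable ω.2 ω.1 (w * W) j} := by
    intro ω hω
    by_cases hG : ω ∈ G
    · exact Or.inr ⟨hG, hω⟩
    · left
      simp only [G, Set.mem_ofPred_eq, not_forall, not_le] at hG
      obtain ⟨b, hb, i, hi⟩ := hG
      simp only [Set.mem_iUnion, Finset.mem_range, Finset.mem_univ, exists_prop, true_and]
      refine ⟨b, hb, i, ?_⟩
      rw [Nat.add_one_mul] at hi
      exact hi
  refine (measure_mono hsub).trans ((measure_union_le _ _).trans ?_)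
  rw [ENNReal.ofReal_add (by positivity) (by positivity)]
  refine add_le_add ?_ (measure_not_chunkDecodable_inter_le hL p j _ G fun φ hφ => ?_)
  · refine (measure_biUnion_finset_le _ _).trans ((Finset.sum_le_sum fun b _ =>
      (measure_biUnion_finset_le _ _).trans (Finset.sum_le_sum fun i _ =>
        measure_activeCount_le p hpm hp j i (b * W) W N hδ hδ1 hN)).trans ?_)
    simp only [Finset.sum_const, Finset.card_range, Finset.card_univ, Fintype.card_fin,
      nsmul_eq_mul]
    rw [ENNReal.ofReal_mul (by positivity), ENNReal.ofReal_mul (by positivity),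
      ENNReal.ofReal_natCast, ENNReal.ofReal_natCast, mul_assoc]
  · have hl2 : 0 < 1 + l := by linarith
    have hc : 0 < l ^ L * (2 / (1 + l)) ^ (N * (w - L)) := by positivity
    -- These factors have mean exactly one, and `z = 1` makes the idle slots invisible, so only the
    -- numbers of coins and heads matter.
    refine (sampleLaw_le_inv_of_le_weight p (x := l * (2 / (1 + l))) (y := 2 / (1 + l)) (z := 1)
      (by positivity) (by positivity) zero_le_one (fun i => ?_) j hφ (w * W) hc ?_).trans ?_
    · refine le_of_eq ?_
      field_simp
      ring
    · rintro ω ⟨hG, hω⟩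
      obtain ⟨n, -, hwt⟩ := weight_eq_of_position_lt (ENNReal.ofReal l)
        (ENNReal.ofReal (2 / (1 + l))) (ENNReal.ofReal 1) hω
      have hcoins := le_coins_of_activeCount hG hω
      have hcoins' : N * (w - L) ≤ coins ω j φ (w * W) := by
        rw [Nat.mul_sub, mul_comm N w]; omega
      rw [ENNReal.ofReal_mul hl.le, hwt, ENNReal.ofReal_one, one_pow, mul_one,
        ENNReal.ofReal_mul (by positivity), ENNReal.ofReal_pow hl.le,
        ENNReal.ofReal_pow (by positivity)]
      gcongr ?_ * ?_
      · exact pow_le_pow_right_of_le_one' (ENNReal.ofReal_le_one.2 hl1) hω.le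
      · refine pow_le_pow_right₀ (ENNReal.one_le_ofReal.2 ?_) hcoins'
        rw [le_div_iff₀ hl2]; linarith
    · refine ENNReal.ofReal_le_ofReal (le_of_eq ?_)
      rw [mul_inv, inv_pow, ← inv_pow (2 / (1 + l)), inv_div]

end FailureProbability

/-! ### Numerical estimates for the chunk size -/

section Numerics

variable [NeZero q]

theorem log_ratio_bounds {L : ℕ} (hL : 2 ≤ L) {b g : ℝ} (hb : 0 < b) (hb1 : b < 1) (hg : 0 < g)
    (hg1 : g < 1) : 2 ≤ L / (b * g) ∧ 1 / 2 ≤ Real.log (L / (b * g)) := by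
  have hL' : (2 : ℝ) ≤ L := by exact_mod_cast hL
  have h : 2 ≤ L / (b * g) := by
    rw [le_div_iff₀ (by positivity)]
    nlinarith [mul_pos hb hg, mul_lt_one_of_nonneg_of_lt_one_left hb.le hb1 hg1.le]
  refine ⟨h, ?_⟩
  have := Real.log_le_log (by norm_num) h
  have := Real.log_two_gt_d9
  linarith

/-- With `y = L / (b g)`, the number of window-link pairs is at most `41 y ^ 2 b`, while the
exponential is at most `y ^ (-10)` and `y ^ 8 ≥ 256`. -/
theorem window_term_le {w L b g x : ℝ} (hL : 2 ≤ L) (hb : 0 < b) (hb1 : b < 1) (hg : 0 < g)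
    (hg1 : g < 1) (hy2 : 2 ≤ L / (b * g)) (hw : w ≤ 41 * L / g)
    (hx : 10 * Real.log (L / (b * g)) ≤ x) : w * L * Real.exp (-x) ≤ b / 2 := by
  have hyb : L / g = L / (b * g) * b := by field_simp
  generalize L / (b * g) = y at *
  have hy0 : 0 < y := by linarith
  have h1 : Real.exp (-x) ≤ (y ^ 10)⁻¹ := by
    rw [← Real.exp_log hy0, ← Real.exp_nat_mul, ← Real.exp_neg]
    refine Real.exp_le_exp.2 ?_
    push_cast
    linarith
  have h2 : w * L ≤ 41 * (y ^ 2 * b) := by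
    calc w * L ≤ 41 * L / g * L := by gcongr
      _ = 41 * ((L / g) * (L / g) * g) := by field_simp
      _ = 41 * (y ^ 2 * b * (b * g)) := by rw [hyb]; ring
      _ ≤ 41 * (y ^ 2 * b * 1) := by
        gcongr
        nlinarith
      _ = _ := by ring
  have h3 : (256 : ℝ) ≤ y ^ 8 := by
    calc (256 : ℝ) = 2 ^ 8 := by norm_num
      _ ≤ y ^ 8 := by gcongr
  calc w * L * Real.exp (-x) ≤ 41 * (y ^ 2 * b) * (y ^ 10)⁻¹ := by gcongr
    _ = 41 * b / y ^ 8 := by field_simp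
    _ ≤ 41 * b / 256 := by gcongr
    _ ≤ b / 2 := by linarith

/-- With `y = L / (b g)`, the surplus `g a / 8` of coins leaves a net exponent of at least `a g / 20
≥ 8 L log y` after `2 ^ a` is paid. Of this, `7 L log y` pays for `(g / 40)⁻¹ ^ L`, and the rest
gives `y⁻¹ ≤ b / 2`. -/
theorem coin_term_le {L a M : ℕ} {b g : ℝ} (hL : (2 : ℝ) ≤ L) (hb : 0 < b) (hb1 : b < 1)
    (hg : 0 < g) (hg1 : g < 1) (hy2 : 2 ≤ L / (b * g)) (ha : 160 * (L * Real.log (L / (b * g))) ≤ a * g)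
    (hM : (1 + g / 8) * a ≤ (M : ℝ)) :
    2 ^ a * ((g / 40)⁻¹ ^ L * ((1 + g / 40) / 2) ^ M) ≤ b / 2 := by
  have hL0 : (0 : ℝ) < L := by linarith
  have hgy : g⁻¹ ≤ L / (b * g) := by
    rw [← one_div]
    refine div_le_div₀ hL0.le (by linarith) (by positivity) ?_
    nlinarith
  have hby : (L / (b * g))⁻¹ ≤ b / 2 := by
    rw [inv_div, div_le_div_iff₀ hL0 (by norm_num)]
    nlinarith
  generalize L / (b * g) = y at *
  have hy0 : 0 < y := by linarith
  have hln2 := Real.log_two_gt_d9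
  have hlog : 0 ≤ Real.log y := Real.log_nonneg (by linarith)
  have e1 : (2 : ℝ) ^ a = Real.exp (a * Real.log 2) := by
    rw [Real.exp_nat_mul, Real.exp_log (by norm_num)]
  have e2 : ((g / 40)⁻¹) ^ L ≤ Real.exp (7 * (L * Real.log y)) := by
    have h1 : (g / 40)⁻¹ ≤ y ^ 7 := by
      have h64 : (40 : ℝ) ≤ y ^ 6 := by
        calc (40 : ℝ) ≤ 2 ^ 6 := by norm_num
          _ ≤ y ^ 6 := by gcongr
      calc (g / 40)⁻¹ = 40 * g⁻¹ := by rw [inv_div]; ring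
        _ ≤ y ^ 6 * y := by gcongr
        _ = y ^ 7 := by ring
    calc ((g / 40)⁻¹) ^ L ≤ (y ^ 7) ^ L := pow_le_pow_left₀ (by positivity) h1 L
      _ = Real.exp (L * (7 * Real.log y)) := by
        rw [Real.exp_nat_mul, mul_comm, Real.exp_mul, Real.exp_log hy0]
        norm_cast
      _ = _ := by ring_nf
  have e3 : ((1 + g / 40) / 2) ^ M ≤ Real.exp ((1 + g / 8) * a * (g / 40 - Real.log 2)) := by
    have h1 : (1 + g / 40) / 2 ≤ Real.exp (g / 40 - Real.log 2) := by
      rw [Real.exp_sub, Real.exp_log (by norm_num)]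
      have := Real.add_one_le_exp (g / 40)
      linarith
    calc _ ≤ Real.exp (g / 40 - Real.log 2) ^ M := pow_le_pow_left₀ (by positivity) h1 M
      _ = Real.exp ((M : ℝ) * (g / 40 - Real.log 2)) := (Real.exp_nat_mul _ _).symm
      _ ≤ _ := by
        refine Real.exp_le_exp.2 (mul_le_mul_of_nonpos_right hM ?_)
        linarith
  calc 2 ^ a * ((g / 40)⁻¹ ^ L * ((1 + g / 40) / 2) ^ M)
      ≤ Real.exp (a * Real.log 2) * (Real.exp (7 * (L * Real.log y)) *
        Real.exp ((1 + g / 8) * a * (g / 40 - Real.log 2))) := by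
        rw [e1]
        exact mul_le_mul_of_nonneg_left (mul_le_mul e2 e3 (by positivity) (by positivity))
          (by positivity)
    _ = Real.exp (a * Real.log 2 + (7 * (L * Real.log y) +
        (1 + g / 8) * a * (g / 40 - Real.log 2))) := by
        rw [← Real.exp_add, ← Real.exp_add]
    _ ≤ Real.exp (-Real.log y) := by
        refine Real.exp_le_exp.2 ?_
        have h1 : Real.log y ≤ L * Real.log y := by nlinarith
        have h2 : a * g * (1 / 20) ≤ a * g * ((Real.log 2) / 8 - (1 + g / 8) / 40) :=
          mul_le_mul_of_nonneg_left (by linarith) (by positivity)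
        linarith
    _ ≤ b / 2 := by rwa [Real.exp_neg, Real.exp_log hy0]

/-- With chunks of the size prescribed in terms of `L`, `b` and `g`, a chunk is not decodable after
the time needed to receive `(1 + g / 4) a` of its packets with probability at most `b`. -/
theorem measure_not_chunkDecodable_le_of_size (hL : 2 ≤ L) (p : Fin L → unitInterval) {pm : ℝ}
    (hpm : 0 < pm) (hp : ∀ i, pm ≤ p i) (j : Fin q) {b g : ℝ} (hb : 0 < b) (hb1 : b < 1)
    (hg : 0 < g) (hg1 : g < 1)
    (ha : 3000000 * (L / g ^ 3 * Real.log (L / (b * g))) ≤ (a : ℝ)) {w W : ℕ}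
    (hw : w = ⌈40 * L / g⌉₊) (hW : (1 + g / 4) * a * q / (pm * w) ≤ W) :
    sampleLaw p q a {ω | ¬ ChunkDecodable ω.2 ω.1 (w * W) j} ≤ ENNReal.ofReal b := by
  obtain ⟨hy2, hlog⟩ := log_ratio_bounds hL hb hb1 hg hg1
  have hL' : (2 : ℝ) ≤ L := by exact_mod_cast hL
  have hL0 : (0 : ℝ) < L := by linarith
  have hq : (0 : ℝ) < q := by exact_mod_cast Nat.pos_of_ne_zero (NeZero.ne q)
  set y : ℝ := L / (b * g) with hy
  set ℓ : ℝ := Real.log y with hℓ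
  have hy0 : 0 < y := by linarith
  have hw1 : 40 * L / g ≤ w := hw ▸ Nat.le_ceil _
  have hw2 : (w : ℝ) ≤ 41 * L / g := by
    have h1 : (w : ℝ) < 40 * L / g + 1 := hw ▸ Nat.ceil_lt_add_one (by positivity)
    have h2 : 1 ≤ L / g := by rw [le_div_iff₀ hg]; linarith
    have h3 : 40 * L / g = 40 * (L / g) := by ring
    have h4 : 41 * L / g = 41 * (L / g) := by ring
    linarith
  have hw0 : (0 : ℝ) < w := lt_of_lt_of_le (by positivity) hw1
  -- The `L` windows given up to movements are at most a fraction `g / 40` of all.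
  have hLw' : (L : ℝ) ≤ g / 40 * w := by
    rw [div_le_iff₀ hg] at hw1; linarith
  have hLw : L ≤ w := by
    have : (L : ℝ) ≤ w := by nlinarith
    exact_mod_cast this
  have ha0 : (0 : ℝ) < a := lt_of_lt_of_le (by positivity) ha
  set μ : ℝ := pm * W / q with hμ
  have hμw : (1 + g / 4) * a ≤ μ * w := by
    rw [div_le_iff₀ (by positivity)] at hW
    rw [hμ, div_mul_eq_mul_div, le_div_iff₀ hq]
    linarith
  have ha3 : 3000000 * (L * ℓ) ≤ a * g ^ 3 := by
    have : 3000000 * (L / g ^ 3 * ℓ) = 3000000 * (L * ℓ) / g ^ 3 := by ring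
    rw [this, div_le_iff₀ (by positivity)] at ha
    exact ha
  have hμ1 : a * g ≤ 41 * L * μ := by
    rw [le_div_iff₀ hg] at hw2
    have hμ0 : 0 ≤ μ := by positivity
    have : a ≤ μ * w := by nlinarith
    calc a * g ≤ μ * w * g := by gcongr
      _ = μ * (w * g) := by ring
      _ ≤ μ * (41 * L) := by gcongr
      _ = _ := by ring
  -- The origin of `g ^ 3`: Chernoff needs `g ^ 2 μ` of order `ℓ`, and a window has only `μ` of
  -- order `a g / L`. The requirement `(g / 40) ^ 2 * μ / 4 ≥ 10 ℓ` amounts to the constant 64000.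
  have hμ2 : 73000 * ℓ ≤ g ^ 2 * μ := by
    have h1 : 3000000 * (L * ℓ) ≤ 41 * L * (g ^ 2 * μ) := by
      calc _ ≤ a * g ^ 3 := ha3
        _ = a * g * g ^ 2 := by ring
        _ ≤ 41 * L * μ * g ^ 2 := by gcongr
        _ = _ := by ring
    have h2 : 3000000 * ℓ ≤ 41 * (g ^ 2 * μ) := by
      have : L * (3000000 * ℓ) ≤ L * (41 * (g ^ 2 * μ)) := by linarith
      exact le_of_mul_le_mul_left this hL0
    linarith
  -- Room for the floor in `N`.
  have hδμ : 1 ≤ g / 40 * μ := by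
    have : g ^ 2 * μ ≤ g * μ := by
      have hμ0 : 0 ≤ μ := by positivity
      nlinarith
    linarith
  set N : ℕ := ⌊(1 - g / 40) * μ⌋₊ with hNdef
  have hN : (N : ℝ) ≤ (1 - g / 40) * μ :=
    Nat.floor_le (mul_nonneg (by linarith) (by positivity))
  have hN' : (1 - g / 20) * μ ≤ N := by
    have := Nat.lt_floor_add_one ((1 - g / 40) * μ)
    rw [← hNdef] at this
    linarith
  refine (measure_not_chunkDecodable_windows_le (by omega) p hpm hp j (δ := g / 40)
    (l := g / 40) (N := N) (by positivity) (by linarith) hN (by positivity) (by linarith)).trans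
    (ENNReal.ofReal_le_ofReal ?_)
  have hM : (1 + g / 8) * a ≤ ((N * (w - L) : ℕ) : ℝ) := by
    rw [Nat.cast_mul, Nat.cast_sub hLw]
    have h1 : (1 - g / 40) * w ≤ w - L := by linarith
    calc (1 + g / 8) * a ≤ (1 - g / 20) * (1 - g / 40) * ((1 + g / 4) * a) := by
          rw [← mul_assoc]
          refine mul_le_mul_of_nonneg_right ?_ ha0.le
          nlinarith [mul_pos hg hg, mul_pos (mul_pos hg hg) hg]
      _ ≤ (1 - g / 20) * (1 - g / 40) * (μ * w) :=
          mul_le_mul_of_nonneg_left hμw (mul_nonneg (by linarith) (by linarith))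
      _ = (1 - g / 20) * μ * ((1 - g / 40) * w) := by ring
      _ ≤ N * (w - L) := mul_le_mul hN' h1 (mul_nonneg (by linarith) hw0.le) (by positivity)
  have hag : 160 * (L * ℓ) ≤ a * g := by
    have h1 : a * g ^ 3 ≤ a * g := by
      refine mul_le_mul_of_nonneg_left ?_ ha0.le
      calc g ^ 3 ≤ g ^ 1 := pow_le_pow_of_le_one hg.le hg1.le (by norm_num)
        _ = g := pow_one g
    have h2 : 0 ≤ L * ℓ := by positivity
    linarith
  have hfirst := window_term_le hL' hb hb1 hg hg1 hy2 hw2 (x := (g / 40) ^ 2 * μ / 4) (by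
    rw [← hy, ← hℓ]; linarith)
  have hsecond := coin_term_le hL' hb hb1 hg hg1 hy2 hag hM
  linarith

end Numerics

/-! ### McDiarmid's inequality by resampling -/

section BoundedDifferences

/-- Hoeffding's lemma on an interval of length `2 c`. The centre `v` need not be the mean; later it
is the value before resampling. -/
theorem lintegral_exp_hoeffding {E : Type*} [MeasurableSpace E] (ν : Measure E)
    [IsProbabilityMeasure ν] {X : E → ℝ} (hX : Measurable X) {v c : ℝ} (hc : 0 ≤ c)
    (hb : ∀ e, |X e - v| ≤ c) (s : ℝ) :
    ∫⁻ e, ENNReal.ofReal (Real.exp (s * (X e - ∫ e', X e' ∂ν))) ∂ν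
      ≤ ENNReal.ofReal (Real.exp (c ^ 2 * s ^ 2 / 2)) := by
  have hmem : ∀ᵐ e ∂ν, X e ∈ Set.Icc (v - c) (v + c) := Eventually.of_forall fun e => by
    have := abs_le.1 (hb e)
    exact ⟨by linarith, by linarith⟩
  have h := hasSubgaussianMGF_of_mem_Icc hX.aemeasurable hmem
  rw [← ofReal_integral_eq_lintegral_ofReal (h.integrable_exp_mul s)
    (Eventually.of_forall fun e => (Real.exp_pos _).le)]
  refine ENNReal.ofReal_le_ofReal ((h.mgf_le s).trans (le_of_eq ?_))
  have : v + c - (v - c) = 2 * c := by ring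
  rw [this]
  simp only [NNReal.coe_pow, NNReal.coe_div, coe_nnnorm, Real.norm_eq_abs, abs_of_nonneg
    (mul_nonneg zero_le_two hc), NNReal.coe_ofNat]
  congr 2
  ring

theorem resample_comm (ω : Sample L q a) {x y : ℕ × Fin L} (hxy : x ≠ y)
    (e e' : Bool × Choice q a) :
    resample (resample ω x e) y e' = resample (resample ω y e') x e := by
  simp only [resample, Function.update_comm hxy]

theorem resample_idem (ω : Sample L q a) (x : ℕ × Fin L) (e e' : Bool × Choice q a) :
    resample (resample ω x e) x e' = resample ω x e' := by
  simp only [resample, Function.update_idem]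

variable [NeZero q]

/-- **McDiarmid's inequality**, for the moment generating function. -/
theorem lintegral_exp_bounded_differences (p : Fin L → unitInterval) {c B : ℝ} (hc : 0 ≤ c)
    (S : Finset (ℕ × Fin L)) :
    ∀ f : Sample L q a → ℝ, Measurable f → (∀ ω, 0 ≤ f ω) → (∀ ω, f ω ≤ B) →
      (∀ ω x e, |f (resample ω x e) - f ω| ≤ c) →
      (∀ ω ω', (∀ x ∈ S, ω.1 x = ω'.1 x ∧ ω.2 x = ω'.2 x) → f ω = f ω') →
      ∃ m : ℝ, 0 ≤ m ∧ ∫⁻ ω, ENNReal.ofReal (f ω) ∂(sampleLaw p q a) = ENNReal.ofReal m ∧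
        ∀ s : ℝ, ∫⁻ ω, ENNReal.ofReal (Real.exp (s * (f ω - m))) ∂(sampleLaw p q a)
          ≤ ENNReal.ofReal (Real.exp (S.card * (c ^ 2 * s ^ 2 / 2))) := by
  classical
  induction S using Finset.induction_on with
  | empty =>
    intro f _ hf0 _ _ hS
    obtain ⟨ω₀⟩ : Nonempty (Sample L q a) := (sampleLaw p q a).nonempty_of_neZero
    have hconst : ∀ ω, f ω = f ω₀ := fun ω => hS ω ω₀ (by simp)
    refine ⟨f ω₀, hf0 ω₀, ?_, fun s => ?_⟩
    · simp [hconst]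
    · simp [hconst]
  | insert x S hx ih =>
    intro f hfm hf0 hfB hbd hS
    set ν := slotLaw (p x.2) q a with hν
    have hjm : Measurable fun z : Sample L q a × (Bool × Choice q a) => f (resample z.1 x z.2) :=
      hfm.comp (measurable_resample x)
    have hem : ∀ ω, Measurable fun e => f (resample ω x e) := fun ω =>
      hjm.comp measurable_prodMk_left
    have hint : ∀ ω, Integrable (fun e => f (resample ω x e)) ν := fun ω =>
      Integrable.of_mem_Icc 0 B (hem ω).aemeasurable
        (Eventually.of_forall fun e => ⟨hf0 _, hfB _⟩)
    -- Integrating out `x` leaves a function of the coordinates in `S` with the same mean and the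
    -- same bounds; passing from `g` to `f` costs one Hoeffding factor.
    let g : Sample L q a → ℝ := fun ω => ∫ e, f (resample ω x e) ∂ν
    have hgm : Measurable g :=
      (hjm.stronglyMeasurable.integral_prod_right' (ν := ν)).measurable
    have hg0 : ∀ ω, 0 ≤ g ω := fun ω => integral_nonneg fun e => hf0 _
    have hgB : ∀ ω, g ω ≤ B := fun ω => by
      have := integral_mono (μ := ν) (hint ω) (integrable_const B) fun e => hfB _
      simpa using this
    have hgbd : ∀ ω y e', |g (resample ω y e') - g ω| ≤ c := by
      intro ω y e'
      by_cases hxy : y = x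
      · subst hxy
        have : g (resample ω y e') = g ω := by
          simp only [g, resample_idem]
        rw [this, sub_self, abs_zero]; exact hc
      · have : g (resample ω y e') - g ω =
            ∫ e, (f (resample (resample ω x e) y e') - f (resample ω x e)) ∂ν := by
          rw [integral_sub _ (hint ω)]
          · simp only [g, resample_comm ω hxy]
          · simpa only [resample_comm ω hxy] using hint (resample ω y e')
        rw [this]
        have h := norm_integral_le_of_norm_le_const (μ := ν) (C := c)
          (f := fun e => f (resample (resample ω x e) y e') - f (resample ω x e))
          (Eventually.of_forall fun e => hbd _ _ _)
        simpa using h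
    have hgS : ∀ ω ω', (∀ y ∈ S, ω.1 y = ω'.1 y ∧ ω.2 y = ω'.2 y) → g ω = g ω' := by
      intro ω ω' h
      refine integral_congr_ae (Eventually.of_forall fun e => hS _ _ fun y hy => ?_)
      by_cases hyx : y = x
      · subst hyx; simp [resample]
      · have := h y ((Finset.mem_insert.1 hy).resolve_left hyx)
        simp [resample, Function.update_of_ne hyx, this]
    obtain ⟨m, hm0, hm, hexp⟩ := ih g hgm hg0 hgB hgbd hgS
    refine ⟨m, hm0, ?_, fun s => ?_⟩
    · rw [← hm, ← lintegral_resample p x hfm.ennreal_ofReal]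
      refine lintegral_congr fun ω => ?_
      rw [← ofReal_integral_eq_lintegral_ofReal (hint ω) (Eventually.of_forall fun e => hf0 _)]
    · have hEm : Measurable fun ω : Sample L q a => ENNReal.ofReal (Real.exp (s * (f ω - m))) := by
        fun_prop
      have hGm : Measurable fun ω : Sample L q a => ENNReal.ofReal (Real.exp (s * (g ω - m))) := by
        fun_prop
      rw [← lintegral_resample p x hEm]
      calc ∫⁻ ω, ∫⁻ e, ENNReal.ofReal (Real.exp (s * (f (resample ω x e) - m))) ∂ν
            ∂(sampleLaw p q a)
          ≤ ∫⁻ ω, ENNReal.ofReal (Real.exp (s * (g ω - m))) *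
              ENNReal.ofReal (Real.exp (c ^ 2 * s ^ 2 / 2)) ∂(sampleLaw p q a) := by
            refine lintegral_mono fun ω => ?_
            have h1 : ∀ e, ENNReal.ofReal (Real.exp (s * (f (resample ω x e) - m))) =
                ENNReal.ofReal (Real.exp (s * (g ω - m))) *
                  ENNReal.ofReal (Real.exp (s * (f (resample ω x e) - g ω))) := by
              intro e
              rw [← ENNReal.ofReal_mul (Real.exp_pos _).le, ← Real.exp_add]
              congr 2
              ring
            simp only [h1]
            have hm' : Measurable fun e =>
                ENNReal.ofReal (Real.exp (s * (f (resample ω x e) - g ω))) := by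
              exact (((hem ω).sub_const _).const_mul s).exp.ennreal_ofReal
            rw [lintegral_const_mul _ hm']
            gcongr
            exact lintegral_exp_hoeffding ν (hem ω) hc (fun e => hbd ω x e) s
        _ ≤ ENNReal.ofReal (Real.exp (S.card * (c ^ 2 * s ^ 2 / 2))) *
              ENNReal.ofReal (Real.exp (c ^ 2 * s ^ 2 / 2)) := by
            rw [lintegral_mul_const _ hGm]
            gcongr
            exact hexp s
        _ = _ := by
            rw [← ENNReal.ofReal_mul (Real.exp_pos _).le, ← Real.exp_add,
              Finset.card_insert_of_notMem hx]
            push_cast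
            congr 2
            ring

end BoundedDifferences

/-! ### Concentration of the number of undecoded chunks -/

section Undecoded

open Classical in
/-- The number of chunks that the sink cannot decode after `t` slots. -/
noncomputable def undecoded (ω : Sample L q a) (t : ℕ) : ℕ :=
  (Finset.univ.filter fun j : Fin q => ¬ ChunkDecodable ω.2 ω.1 t j).card

open Classical in
theorem undecoded_eq_sum (ω : Sample L q a) (t : ℕ) :
    (undecoded ω t : ℝ) = ∑ j : Fin q, if ChunkDecodable ω.2 ω.1 t j then 0 else 1 := by
  unfold undecoded
  rw [Finset.card_filter]
  push_cast
  exact Finset.sum_congr rfl fun j _ => by split_ifs <;> simp_all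

theorem measurable_undecoded (t : ℕ) :
    Measurable fun ω : Sample L q a => (undecoded ω t : ℝ) := by
  classical
  simp only [undecoded_eq_sum]
  exact Finset.measurable_fun_sum _ fun j _ =>
    Measurable.ite (measurableSet_chunkDecodable t j) measurable_const measurable_const

/-- Only the old and the new chunk of the transmission are affected, since the effects downstream
stay within a chunk. Hence 2, whatever `L` is. -/
theorem abs_undecoded_resample_sub_le (ω : Sample L q a) (t : ℕ) (x : ℕ × Fin L)
    (e : Bool × Choice q a) : |(undecoded (resample ω x e) t : ℝ) - undecoded ω t| ≤ 2 := by
  classical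
  rw [undecoded_eq_sum, undecoded_eq_sum, ← Finset.sum_sub_distrib]
  refine (Finset.abs_sum_le_sum_abs _ _).trans ?_
  calc _ ≤ ∑ j : Fin q, ((if (ω.2 x).1 = j then (1 : ℝ) else 0) + if e.2.1 = j then 1 else 0) := by
        refine Finset.sum_le_sum fun j _ => ?_
        by_cases h1 : (ω.2 x).1 = j
        · rw [if_pos h1]
          split_ifs <;> norm_num
        · by_cases h2 : e.2.1 = j
          · rw [if_pos h2]
            split_ifs <;> norm_num
          · simp only [(agreeOn_resample_of_ne ω t h1 h2).chunkDecodable_iff]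
            simp [h1, h2]
    _ = 2 := by rw [Finset.sum_add_distrib]; simp; norm_num

variable [NeZero q]

theorem lintegral_undecoded (p : Fin L → unitInterval) (t : ℕ) :
    ∫⁻ ω, ENNReal.ofReal (undecoded ω t) ∂(sampleLaw p q a)
      = ∑ j : Fin q, sampleLaw p q a {ω | ¬ ChunkDecodable ω.2 ω.1 t j} := by
  classical
  have : ∀ ω : Sample L q a, ENNReal.ofReal (undecoded ω t) =
      ∑ j : Fin q, Set.indicator {ω : Sample L q a | ¬ ChunkDecodable ω.2 ω.1 t j} 1 ω := by
    intro ω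
    rw [undecoded_eq_sum, ENNReal.ofReal_sum_of_nonneg fun j _ => by split_ifs <;> norm_num]
    refine Finset.sum_congr rfl fun j _ => ?_
    simp only [Set.indicator_apply, Set.mem_ofPred_eq]
    split_ifs <;> simp_all
  simp only [this]
  have hms : ∀ j, MeasurableSet {ω : Sample L q a | ¬ ChunkDecodable ω.2 ω.1 t j} := fun j =>
    (measurableSet_chunkDecodable t j).compl
  rw [lintegral_finsetSum _ fun j _ => measurable_one.indicator (hms j)]
  exact Finset.sum_congr rfl fun j _ =>
    lintegral_indicator_one (hms j)

theorem measure_undecoded_ge_le_exp (p : Fin L → unitInterval) (hL : 0 < L) {t : ℕ} (ht : 0 < t)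
    {b h : ℝ} (hb : 0 ≤ b) (hh : 0 ≤ h)
    (hdec : ∀ j, sampleLaw p q a {ω | ¬ ChunkDecodable ω.2 ω.1 t j} ≤ ENNReal.ofReal b) :
    sampleLaw p q a {ω | q * b + h ≤ undecoded ω t}
      ≤ ENNReal.ofReal (Real.exp (-(h ^ 2 / (8 * (t * L))))) := by
  classical
  let S : Finset (ℕ × Fin L) := Finset.range t ×ˢ Finset.univ
  have hS : (S.card : ℝ) = t * L := by simp [S]
  obtain ⟨m, hm0, hm, hexp⟩ := lintegral_exp_bounded_differences (q := q) (a := a) p (c := 2)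
    (B := q) zero_le_two S (fun ω => (undecoded ω t : ℝ)) (measurable_undecoded t)
    (fun ω => Nat.cast_nonneg _) (fun ω => by
      have : undecoded ω t ≤ q := (Finset.card_filter_le _ _).trans (by simp)
      exact_mod_cast this)
    (fun ω x e => abs_undecoded_resample_sub_le ω t x e) (fun ω ω' h => by
      have : ∀ j, ChunkDecodable ω.2 ω.1 t j ↔ ChunkDecodable ω'.2 ω'.1 t j := fun j =>
        AgreeOn.chunkDecodable_iff fun s hs i => Or.inl (h (s, i) (by simp [S, hs]))
      simp only [undecoded_eq_sum, this])
  have hmq : m ≤ q * b := by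
    rw [lintegral_undecoded] at hm
    have : ENNReal.ofReal m ≤ ENNReal.ofReal (q * b) := by
      rw [← hm]
      refine (Finset.sum_le_sum fun j _ => hdec j).trans (le_of_eq ?_)
      rw [Finset.sum_const, nsmul_eq_mul, Finset.card_univ, Fintype.card_fin,
        ENNReal.ofReal_mul (by positivity), ENNReal.ofReal_natCast]
    exact (ENNReal.ofReal_le_ofReal_iff (by positivity)).1 this
  have hN : (0 : ℝ) < t * L := by positivity
  -- The minimiser of `2 t L s ^ 2 - s h`.
  set s : ℝ := h / (4 * (t * L)) with hs
  have hs0 : 0 ≤ s := by positivity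
  have hmeas : Measurable fun ω : Sample L q a =>
      ENNReal.ofReal (Real.exp (s * (undecoded ω t - m))) := by
    have := measurable_undecoded (L := L) (q := q) (a := a) t
    fun_prop
  have h1 := mul_meas_ge_le_lintegral (μ := sampleLaw p q a) hmeas
    (ENNReal.ofReal (Real.exp (s * h)))
  have hsub : {ω : Sample L q a | q * b + h ≤ undecoded ω t} ⊆
      {ω | ENNReal.ofReal (Real.exp (s * h)) ≤
        ENNReal.ofReal (Real.exp (s * (undecoded ω t - m)))} := by
    intro ω hω
    have hω : q * b + h ≤ undecoded ω t := hω
    refine ENNReal.ofReal_le_ofReal (Real.exp_le_exp.2 ?_)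
    exact mul_le_mul_of_nonneg_left (by linarith) hs0
  have h2 : sampleLaw p q a {ω | q * b + h ≤ undecoded ω t} ≤
      ENNReal.ofReal (Real.exp (S.card * (2 ^ 2 * s ^ 2 / 2))) /
        ENNReal.ofReal (Real.exp (s * h)) := by
    rw [ENNReal.le_div_iff_mul_le (Or.inl (by simp [Real.exp_pos]))
      (Or.inl ENNReal.ofReal_ne_top), mul_comm]
    exact (mul_le_mul_right (measure_mono hsub) _).trans (h1.trans (hexp s))
  refine h2.trans (le_of_eq ?_)
  rw [← ENNReal.ofReal_div_of_pos (Real.exp_pos _), ← Real.exp_sub, hS, hs]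
  congr 2
  field_simp
  ring

theorem measure_undecoded_gt_le (p : Fin L → unitInterval) (t : ℕ)
    {b r : ℝ} (hb : 0 < b)
    (hdec : ∀ j, sampleLaw p q a {ω | ¬ ChunkDecodable ω.2 ω.1 t j} ≤ ENNReal.ofReal r) :
    sampleLaw p q a {ω | b * q < undecoded ω t} ≤ ENNReal.ofReal (r / b) := by
  have hq : (0 : ℝ) < q := by exact_mod_cast Nat.pos_of_ne_zero (NeZero.ne q)
  have hbq : 0 < b * q := by positivity
  have h1 := mul_meas_ge_le_lintegral (μ := sampleLaw p q a)
    (measurable_undecoded (L := L) (q := q) (a := a) t).ennreal_ofReal (ENNReal.ofReal (b * q))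
  have h2 : ∫⁻ ω, ENNReal.ofReal (undecoded ω t) ∂(sampleLaw p q a) ≤ ENNReal.ofReal (q * r) := by
    rw [lintegral_undecoded]
    refine (Finset.sum_le_sum fun j _ => hdec j).trans (le_of_eq ?_)
    rw [Finset.sum_const, nsmul_eq_mul, Finset.card_univ, Fintype.card_fin,
      ENNReal.ofReal_mul (by positivity), ENNReal.ofReal_natCast]
  have h3 : r / b = q * r / (b * q) := by field_simp
  rw [h3, ENNReal.ofReal_div_of_pos hbq, ENNReal.le_div_iff_mul_le
    (Or.inl (by simpa using hbq)) (Or.inl ENNReal.ofReal_ne_top), mul_comm]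
  refine (mul_le_mul_right (measure_mono fun ω hω => ?_) _).trans (h1.trans h2)
  exact ENNReal.ofReal_le_ofReal (le_of_lt hω)

end Undecoded

/-! ### From undecoded chunks to the average coding delay -/

section Delay

theorem undecoded_antitone (ω : Sample L q a) : Antitone (undecoded ω) := by
  classical
  intro t t' h
  refine Finset.card_le_card fun j => ?_
  simp only [Finset.mem_filter, Finset.mem_univ, true_and]
  refine mt fun hd => top_le_iff.1 ?_
  rw [← (show Submodule.span (ZMod 2) (sinkVectors ω.2 ω.1 t j) = ⊤ from hd)]
  exact Submodule.span_mono fun v ⟨s, hs, hv⟩ => ⟨s, hs.trans_le h, hv⟩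

/-- Chunks are blocks of equal size, so the fraction of erased code symbols is at most the fraction
of undecoded chunks. -/
theorem recovered_of_undecoded_le {k : ℕ} {F : Type*} {enc : (Fin k → F) → (Fin q × Fin a → F)}
    {b : ℝ} (henc : CorrectsErasures enc b) {ω : Sample L q a} {t : ℕ}
    (h : (undecoded ω t : ℝ) ≤ b * q) : Recovered enc ω.2 ω.1 t := by
  classical
  intro m m' hmm
  refine henc ((Finset.univ.filter fun j : Fin q => ¬ ChunkDecodable ω.2 ω.1 t j) ×ˢ Finset.univ)
    ?_ m m' fun ⟨j, x⟩ hj => hmm j ?_ x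
  · have : ((undecoded ω t : ℝ)) * a ≤ b * q * a := by gcongr
    rw [Finset.card_product]
    simpa [undecoded, mul_assoc] using this
  · simpa using hj

/-- Each slot from `T₀` on that precedes the first one with few undecoded chunks contributes one to
the series; if there is no such slot, the series is infinite. -/
theorem codingDelay_le {k : ℕ} {F : Type*} {enc : (Fin k → F) → (Fin q × Fin a → F)}
    {b : ℝ} (henc : CorrectsErasures enc b) (ω : Sample L q a) (T₀ : ℕ) :
    codingDelay enc ω.2 ω.1 ≤ T₀ +
      ∑' t : ℕ, Set.indicator {ω : Sample L q a | b * q < undecoded ω (T₀ + t)} 1 ω := by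
  classical
  by_cases h : ∃ t, ¬ b * q < undecoded ω (T₀ + t)
  · have hd := Nat.find_spec h
    have h1 : codingDelay enc ω.2 ω.1 ≤ ((T₀ + Nat.find h : ℕ) : ℝ≥0∞) :=
      iInf₂_le _ (recovered_of_undecoded_le henc (not_lt.1 hd))
    refine h1.trans ?_
    push_cast
    gcongr
    refine le_trans ?_ (ENNReal.sum_le_tsum (Finset.range (Nat.find h)))
    rw [Finset.sum_congr rfl (g := fun _ => (1 : ℝ≥0∞))]
    · simp
    · intro t ht
      have := not_not.1 (Nat.find_min h (Finset.mem_range.1 ht))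
      simp [this]
  · push Not at h
    have : ∀ t : ℕ, Set.indicator {ω : Sample L q a | b * q < undecoded ω (T₀ + t)}
        (1 : Sample L q a → ℝ≥0∞) ω = 1 := fun t => by simp [h t]
    simp only [this, ENNReal.tsum_const_eq_top_of_ne_zero one_ne_zero, add_top, le_top]

theorem measurableSet_undecoded_gt (b : ℝ) (t : ℕ) :
    MeasurableSet {ω : Sample L q a | b * q < undecoded ω t} :=
  measurableSet_lt measurable_const (measurable_undecoded t)

variable [NeZero q]

/-- Markov's inequality for the average coding delay. -/
theorem codeLaw_averageCodingDelay_gt_le_tsum (p : Fin L → unitInterval) {k : ℕ} {F : Type*}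
    {enc : (Fin k → F) → (Fin q × Fin a → F)} {b : ℝ} (henc : CorrectsErasures enc b) (T₀ : ℕ)
    {Δ τ : ℝ} (hΔ : 0 < Δ) (hτ : T₀ + Δ ≤ τ) :
    codeLaw L q a {C | ENNReal.ofReal τ < averageCodingDelay p enc C}
      ≤ (∑' t : ℕ, sampleLaw p q a {ω | b * q < undecoded ω (T₀ + t)}) / ENNReal.ofReal Δ := by
  let B : ℕ → Set (Sample L q a) := fun t => {ω | b * q < undecoded ω (T₀ + t)}
  have hB : ∀ t, MeasurableSet (B t) := fun t => measurableSet_undecoded_gt b _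
  -- A bound on the mean excess delay over `T₀` for a fixed code; by Tonelli its mean over codes is
  -- the series in the statement.
  let H : Code L q a → ℝ≥0∞ := fun C => ∑' t, trafficLaw p {T | (T, C) ∈ B t}
  have hHt : ∀ t, Measurable fun C : Code L q a => trafficLaw p {T | (T, C) ∈ B t} := fun t =>
    measurable_measure_prodMk_right (hB t)
  have hH : Measurable H := Measurable.tsum hHt
  have havg : ∀ C, averageCodingDelay p enc C ≤ T₀ + H C := by
    intro C
    have hs : ∀ t, MeasurableSet {T : Traffic L | (T, C) ∈ B t} := fun t =>
      measurable_prodMk_right (hB t)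
    calc averageCodingDelay p enc C
        ≤ ∫⁻ T, (T₀ + ∑' t : ℕ, Set.indicator {T : Traffic L | (T, C) ∈ B t} 1 T)
            ∂(trafficLaw p) :=
          lintegral_mono fun T => codingDelay_le henc (T, C) T₀
      _ = T₀ + H C := by
          rw [lintegral_add_left measurable_const, lintegral_const, measure_univ, mul_one,
            lintegral_tsum fun t => (measurable_one.indicator (hs t)).aemeasurable]
          simp only [fun t => lintegral_indicator_one (μ := trafficLaw p) (hs t), H]
  have hHint : ∫⁻ C, H C ∂(codeLaw L q a) = ∑' t, sampleLaw p q a (B t) := by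
    rw [lintegral_tsum fun t => (hHt t).aemeasurable]
    refine tsum_congr fun t => ?_
    rw [sampleLaw, Measure.prod_apply_symm (hB t)]
    rfl
  have h1 := mul_meas_ge_le_lintegral (μ := codeLaw L q a) hH (ENNReal.ofReal Δ)
  rw [hHint] at h1
  rw [ENNReal.le_div_iff_mul_le (Or.inl (by simpa using hΔ)) (Or.inl ENNReal.ofReal_ne_top),
    mul_comm]
  refine (mul_le_mul_right (measure_mono fun C hC => ?_) _).trans h1
  by_contra hlt
  have hlt : H C < ENNReal.ofReal Δ := not_le.1 hlt
  refine absurd hC (not_lt.2 ((havg C).trans ?_))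
  calc (T₀ : ℝ≥0∞) + H C ≤ ENNReal.ofReal T₀ + ENNReal.ofReal Δ := by
        rw [ENNReal.ofReal_natCast]; gcongr
    _ = ENNReal.ofReal (T₀ + Δ) := (ENNReal.ofReal_add (by positivity) hΔ.le).symm
    _ ≤ ENNReal.ofReal τ := ENNReal.ofReal_le_ofReal hτ

end Delay

/-! ### Summing the tail -/

section Tail

theorem tsum_exp_neg_le {K κ : ℝ} (hK : 0 ≤ K) (hκ : 0 < κ) (hκ1 : κ ≤ 1 / 2) (T : ℕ) :
    ∑' t : ℕ, ENNReal.ofReal (K * Real.exp (-κ * (T + t : ℕ)))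
      ≤ ENNReal.ofReal (K * Real.exp (-κ * T) * (2 / κ)) := by
  have he : Real.exp (-κ) < 1 := Real.exp_lt_one_iff.2 (by linarith)
  have h1 : ∀ t : ℕ, K * Real.exp (-κ * (T + t : ℕ)) =
      K * Real.exp (-κ * T) * Real.exp (-κ) ^ t := by
    intro t
    rw [← Real.exp_nat_mul, mul_assoc, ← Real.exp_add]
    push_cast
    ring_nf
  have hsum : Summable fun t : ℕ => Real.exp (-κ) ^ t :=
    summable_geometric_of_lt_one (Real.exp_pos _).le he
  simp only [h1]
  rw [← ENNReal.ofReal_tsum_of_nonneg (fun t => by positivity) (hsum.mul_left _), tsum_mul_left,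
    tsum_geometric_of_lt_one (Real.exp_pos _).le he]
  refine ENNReal.ofReal_le_ofReal ?_
  gcongr
  rw [← one_div, div_le_div_iff₀ (by linarith) hκ]
  have := (abs_le.1 (Real.abs_exp_sub_one_sub_id_le (x := -κ)
    (by rw [abs_le]; constructor <;> linarith))).2
  nlinarith

/-- The first `T₁` terms are bounded by `P T₀`; beyond them `P (T₀ + T₁ + t) ≤ P (T₁ + t)` and the
exponential bound is summed. -/
theorem tsum_le_of_antitone_of_exp {P : ℕ → ℝ≥0∞} (hP : Antitone P) {e K κ : ℝ} (he : 0 ≤ e)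
    (hK : 0 ≤ K) (hκ : 0 < κ) (hκ1 : κ ≤ 1 / 2) {T₀ T₁ : ℕ} (h0 : P T₀ ≤ ENNReal.ofReal e)
    (h1 : ∀ t, T₁ ≤ t → P t ≤ ENNReal.ofReal (K * Real.exp (-κ * t))) :
    ∑' t : ℕ, P (T₀ + t) ≤ ENNReal.ofReal (T₁ * e + K * Real.exp (-κ * T₁) * (2 / κ)) := by
  rw [← Summable.sum_add_tsum_nat_add' (f := fun t => P (T₀ + t)) (k := T₁) ENNReal.summable,
    ENNReal.ofReal_add (by positivity) (by positivity)]
  refine add_le_add ?_ ((ENNReal.tsum_le_tsum fun t => ?_).trans (tsum_exp_neg_le hK hκ hκ1 T₁))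
  · refine (Finset.sum_le_sum fun t _ => (hP (Nat.le_add_right T₀ t)).trans h0).trans ?_
    rw [Finset.sum_const, Finset.card_range, nsmul_eq_mul, ENNReal.ofReal_mul (by positivity),
      ENNReal.ofReal_natCast]
  · refine (hP ?_).trans (h1 (T₁ + t) (Nat.le_add_right _ _))
    omega

/-- The cutoff is `x q a` rounded up: proportional to the block length, so that both terms are small
multiples of `q a`, yet late enough for a decay of `exp (-(pm x / 8))`. -/
theorem exists_cutoff {q a pm x E K c : ℝ} (hq : 1 ≤ q) (ha : 1 ≤ a) (hpm : 0 < pm) (hpm1 : pm ≤ 1)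
    (hx : 8 ≤ pm * x) (hE : 0 ≤ E) (hK : 0 ≤ K) (h1 : 2 * x * E ≤ c)
    (h2 : K * (16 / pm) * Real.exp (-(pm * x / 8)) ≤ c) :
    ∃ T : ℕ, 8 * (q * a) / pm ≤ T ∧
      T * E + K * Real.exp (-(pm / (8 * q)) * T) * (2 / (pm / (8 * q))) ≤ 2 * c * (q * a) := by
  have hx0 : 0 < x := by
    by_contra h
    nlinarith [not_lt.1 h]
  have hx8 : 8 ≤ x := by nlinarith
  have hqa : 1 ≤ q * a := by nlinarith
  have hq0 : 0 < q := by linarith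
  refine ⟨⌈x * (q * a)⌉₊, ?_, ?_⟩
  · refine le_trans ?_ (Nat.le_ceil _)
    rw [div_le_iff₀ hpm]
    nlinarith
  · have hle : x * (q * a) ≤ ⌈x * (q * a)⌉₊ := Nat.le_ceil _
    have hlt : (⌈x * (q * a)⌉₊ : ℝ) < x * (q * a) + 1 := Nat.ceil_lt_add_one (by positivity)
    generalize (⌈x * (q * a)⌉₊ : ℝ) = T at *
    have hT : T ≤ 2 * x * (q * a) := by nlinarith
    have e1 : T * E ≤ c * (q * a) := by
      calc T * E ≤ 2 * x * (q * a) * E := by gcongr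
        _ = 2 * x * E * (q * a) := by ring
        _ ≤ _ := by gcongr
    have e2 : Real.exp (-(pm / (8 * q)) * T) ≤ Real.exp (-(pm * x / 8)) := by
      refine Real.exp_le_exp.2 ?_
      rw [neg_mul]
      refine neg_le_neg ?_
      calc pm * x / 8 ≤ pm * x / 8 * a := le_mul_of_one_le_right (by positivity) ha
        _ = pm / (8 * q) * (x * (q * a)) := by field_simp
        _ ≤ _ := by gcongr
    have e3 : q ≤ q * a := le_mul_of_one_le_right hq0.le ha
    have hc : 0 ≤ c := le_trans (by positivity) h1
    have e4 : K * Real.exp (-(pm / (8 * q)) * T) * (2 / (pm / (8 * q))) ≤ c * (q * a) := by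
      calc K * Real.exp (-(pm / (8 * q)) * T) * (2 / (pm / (8 * q)))
          = K * (16 / pm) * Real.exp (-(pm / (8 * q)) * T) * q := by field_simp; ring
        _ ≤ K * (16 / pm) * Real.exp (-(pm * x / 8)) * q := by gcongr
        _ ≤ c * (q * a) := by gcongr
    linarith

end Tail

/-! ### The bound for a fixed message length -/

section FixedLength

variable [NeZero q]

/-- From time `8 q a / pm` on, half of the exponent of the crude bound pays for `2 ^ a`. -/
theorem measure_undecoded_gt_le_exp (hL : 0 < L) (p : Fin L → unitInterval) {pm : ℝ}
    (hpm : 0 < pm) (hp : ∀ i, pm ≤ p i) {b : ℝ} (hb : 0 < b) {t : ℕ}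
    (ht : 8 * (q * a) / pm ≤ (t : ℝ)) :
    sampleLaw p q a {ω | b * q < undecoded ω t}
      ≤ ENNReal.ofReal (2 ^ L / b * Real.exp (-(pm / (8 * q)) * t)) := by
  have hq : (0 : ℝ) < q := by exact_mod_cast Nat.pos_of_ne_zero (NeZero.ne q)
  refine (measure_undecoded_gt_le p t hb fun j =>
    measure_not_chunkDecodable_le hL p hp j t).trans (ENNReal.ofReal_le_ofReal ?_)
  have h1 : (2 : ℝ) ^ a * Real.exp (-(pm / (4 * q)) * t) ≤ Real.exp (-(pm / (8 * q)) * t) := by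
    have e1 : (2 : ℝ) ^ a = Real.exp (a * Real.log 2) := by
      rw [Real.exp_nat_mul, Real.exp_log (by norm_num)]
    rw [e1, ← Real.exp_add]
    refine Real.exp_le_exp.2 ?_
    have h2 : (a : ℝ) ≤ pm / (8 * q) * t := by
      rw [div_le_iff₀ hpm] at ht
      rw [div_mul_eq_mul_div, le_div_iff₀ (by positivity)]
      linarith
    have h3 : pm / (4 * q) = 2 * (pm / (8 * q)) := by ring
    have h4 : a * Real.log 2 ≤ a * 1 := by
      gcongr
      have := Real.log_two_lt_d9
      linarith
    rw [h3]
    linarith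
  calc 2 ^ a * (2 ^ L * Real.exp (-(pm / (4 * q)) * t)) / b
      = 2 ^ L / b * (2 ^ a * Real.exp (-(pm / (4 * q)) * t)) := by ring
    _ ≤ _ := by gcongr

/-- The bound for a message of fixed length, in terms of the constants of the tail estimates. -/
theorem codeLaw_averageCodingDelay_gt_le (hL : 2 ≤ L) (p : Fin L → unitInterval) {pm : ℝ}
    (hpm : 0 < pm) (hp : ∀ i, pm ≤ p i) {k : ℕ} {F : Type*}
    {enc : (Fin k → F) → (Fin q × Fin a → F)} {γa b g : ℝ} (hγa : 0 < γa)
    (hb : 0 < b) (hb1 : b < 1) (hg : 0 < g) (hg1 : g < 1)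
    (henc : CorrectsErasures enc ((1 + γa) * b))
    (ha : 3000000 * (L / g ^ 3 * Real.log (L / (b * g))) ≤ (a : ℝ))
    (hw : (⌈40 * L / g⌉₊ : ℝ) ≤ g / 8 * (q * a)) {ε Λ D M τ : ℝ} (hε : 0 < ε) (hD : 8 ≤ pm * (D * Λ))
    (hM : M * Λ ≤ (γa * b) ^ 2 * q * pm / (16 * (a * L)))
    (h1 : 2 * (D * Λ) * Real.exp (-(M * Λ)) ≤ g / 16 * ε)
    (h2 : 2 ^ L / ((1 + γa) * b) * (16 / pm) * Real.exp (-(pm * (D * Λ) / 8)) ≤ g / 16 * ε)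
    (hτ : (1 + g / 2) * (q * a) / pm ≤ τ) :
    codeLaw L q a {C | ENNReal.ofReal τ < averageCodingDelay p enc C} ≤ ENNReal.ofReal ε := by
  have hq : (1 : ℝ) ≤ q := by exact_mod_cast Nat.pos_of_ne_zero (NeZero.ne q)
  have hq0 : (0 : ℝ) < q := by linarith
  have hL' : (2 : ℝ) ≤ L := by exact_mod_cast hL
  have hpm1 : pm ≤ 1 := (hp ⟨0, by omega⟩).trans (p _).2.2
  have hlog := (log_ratio_bounds hL hb hb1 hg hg1).2
  have ha0 : (0 : ℝ) < a := lt_of_lt_of_le (by positivity) ha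
  have ha1 : (1 : ℝ) ≤ a := by exact_mod_cast Nat.one_le_iff_ne_zero.2 (by rintro rfl; simp at ha0)
  set n : ℝ := q * a with hn
  have hn0 : 0 < n := by positivity
  have hn1 : 1 ≤ n := by nlinarith
  set w : ℕ := ⌈40 * L / g⌉₊ with hwdef
  have hw0 : (0 : ℝ) < w := lt_of_lt_of_le (by positivity) (Nat.le_ceil _)
  set W : ℕ := ⌈(1 + g / 4) * a * q / (pm * w)⌉₊ with hW
  have hWle : (1 + g / 4) * a * q / (pm * w) ≤ W := Nat.le_ceil _
  have hW0 : (0 : ℝ) < W := lt_of_lt_of_le (by positivity) hWle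
  have hWlt : (W : ℝ) < (1 + g / 4) * a * q / (pm * w) + 1 := Nat.ceil_lt_add_one (by positivity)
  set T₀ : ℕ := w * W with hT₀
  have hT₀pos : 0 < T₀ := by
    have : (0 : ℝ) < (w : ℝ) * W := by positivity
    exact_mod_cast this
  have hnp : n ≤ n / pm := by rw [le_div_iff₀ hpm]; nlinarith
  -- Rounding `W` up costs at most `w` slots, which `hw` keeps below `g n / 8`.
  have hT₀le : (T₀ : ℝ) ≤ (1 + 3 * g / 8) * (n / pm) := by
    have e1 : (w : ℝ) * ((1 + g / 4) * a * q / (pm * w) + 1) = (1 + g / 4) * (n / pm) + w := by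
      rw [hn]; field_simp
    have e2 : (T₀ : ℝ) ≤ w * ((1 + g / 4) * a * q / (pm * w) + 1) := by
      rw [hT₀]; push_cast; gcongr
    have e3 : g / 8 * n ≤ g / 8 * (n / pm) := by gcongr
    linarith
  have hT₀le2 : (T₀ : ℝ) ≤ 2 * (n / pm) := by
    have : 0 < n / pm := by positivity
    nlinarith
  have hdec := fun j => measure_not_chunkDecodable_le_of_size (q := q) hL p hpm hp j hb hb1 hg hg1
    ha hwdef hWle
  have hP0 : sampleLaw p q a {ω | (1 + γa) * b * q < undecoded ω T₀} ≤
      ENNReal.ofReal (Real.exp (-(M * Λ))) := by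
    have hsub : {ω : Sample L q a | (1 + γa) * b * q < undecoded ω T₀} ⊆
        {ω | q * b + γa * b * q ≤ undecoded ω T₀} := by
      intro ω hω
      have hω : (1 + γa) * b * q < undecoded ω T₀ := hω
      change (q * b + γa * b * q : ℝ) ≤ undecoded ω T₀
      linarith
    refine (measure_mono hsub).trans ((measure_undecoded_ge_le_exp p (by omega) hT₀pos hb.le
      (by positivity) hdec).trans (ENNReal.ofReal_le_ofReal (Real.exp_le_exp.2 (neg_le_neg ?_))))
    refine hM.trans ?_
    calc (γa * b) ^ 2 * q * pm / (16 * (a * L)) = (γa * b * q) ^ 2 / (8 * (2 * (n / pm) * L)) := by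
          rw [hn]; field_simp; ring
      _ ≤ _ := by gcongr
  have hκ : pm / (8 * q) ≤ 1 / 2 := by
    rw [div_le_div_iff₀ (by positivity) (by norm_num)]
    linarith
  obtain ⟨T₁, hT₁8, hT₁⟩ := exists_cutoff hq ha1 hpm hpm1 hD (Real.exp_pos _).le
    (K := 2 ^ L / ((1 + γa) * b)) (by positivity) h1 h2
  have hanti : Antitone fun t => sampleLaw p q a {ω | (1 + γa) * b * q < undecoded ω t} := by
    intro t t' h
    refine measure_mono fun ω hω => ?_
    have hω : (1 + γa) * b * q < undecoded ω t' := hω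
    have hle : (undecoded ω t' : ℝ) ≤ undecoded ω t := by exact_mod_cast undecoded_antitone ω h
    exact hω.trans_le hle
  have hsum := tsum_le_of_antitone_of_exp hanti (Real.exp_pos _).le (K := 2 ^ L / ((1 + γa) * b))
    (κ := pm / (8 * q)) (by positivity) (by positivity) hκ hP0 (T₁ := T₁)
    fun t ht => measure_undecoded_gt_le_exp (by omega) p hpm hp (by positivity)
      (hT₁8.trans (by exact_mod_cast ht))
  -- The last `g / 8` of the slack `g / 2` is the excess allowed in Markov's inequality; `h1` and
  -- `h2` make the series at most `ε` times it.
  have hΔ : 0 < g / 8 * n := by positivity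
  refine (codeLaw_averageCodingDelay_gt_le_tsum p henc T₀ hΔ (τ := τ) ?_).trans ?_
  · have e1 : g / 8 * n ≤ g / 8 * (n / pm) := by gcongr
    have e2 : (1 + g / 2) * n / pm = (1 + g / 2) * (n / pm) := by ring
    rw [e2] at hτ
    linarith
  · rw [ENNReal.div_le_iff_le_mul (Or.inl (by simpa using hΔ)) (Or.inl ENNReal.ofReal_ne_top),
      ← ENNReal.ofReal_mul hε.le]
    refine hsum.trans (ENNReal.ofReal_le_ofReal (hT₁.trans (le_of_eq ?_)))
    ring

end FixedLength

/-! ### Positivity of the parameters and choice of constants -/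

section Parameters

theorem minParam_le (p : Fin L → unitInterval) (i : Fin L) : minParam p ≤ p i :=
  ciInf_le (Set.finite_range _).bddBelow i

theorem minParam_pos (hL : 2 ≤ L) {p : Fin L → unitInterval} (hp : ∀ i, 0 < (p i : ℝ)) :
    0 < minParam p := by
  have : Nonempty (Fin L) := ⟨⟨0, by omega⟩⟩
  obtain ⟨i, hi⟩ := exists_eq_ciInf_of_finite (f := fun i => (p i : ℝ))
  rw [minParam, ← hi]
  exact hp i

theorem minGap_pos (hL : 2 ≤ L) {p : Fin L → unitInterval} (hp : Function.Injective p) :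
    0 < minGap p := by
  have : Nonempty {e : Fin L × Fin L // (e.1 : ℕ) + 1 = e.2} :=
    ⟨⟨(⟨0, by omega⟩, ⟨1, by omega⟩), rfl⟩⟩
  obtain ⟨e, he⟩ := exists_eq_ciInf_of_finite
    (f := fun e : {e : Fin L × Fin L // (e.1 : ℕ) + 1 = e.2} =>
      |(p e.1.2 : ℝ) - (p e.1.1 : ℝ)|)
  rw [minGap, ← he, abs_pos, sub_ne_zero]
  intro h
  have h1 : e.1.2 = e.1.1 := hp (Subtype.ext h)
  have h2 := e.2
  rw [h1] at h2
  omega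

theorem exists_exp_neg_mul_le {c l : ℝ} (hc : 0 < c) (hl : 0 < l) :
    ∃ x : ℝ, 0 ≤ x ∧ ∀ y, l ≤ y → Real.exp (-(x * y)) ≤ c := by
  refine ⟨|Real.log c| / l, by positivity, fun y hy => ?_⟩
  rw [← Real.le_log_iff_exp_le hc]
  have h1 : |Real.log c| ≤ |Real.log c| / l * y := by
    rw [div_mul_eq_mul_div, le_div_iff₀ hl]
    gcongr
  have := neg_abs_le (Real.log c)
  linarith

end Parameters

/-! ### Message length tending to infinity -/

section Asymptotics

/-- The average coding delay for message lengths tending to infinity, with the size of the chunks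
bounded below in terms of `L`, `γb` and `g`. -/
theorem eventually_codeLaw_averageCodingDelay_gt_le {L : ℕ} (hL : 2 ≤ L)
    {p : Fin L → unitInterval} (hp0 : ∀ i, 0 < (p i : ℝ)) {γa γb g : ℝ} (ha0 : 0 < γa)
    (hb0 : 0 < γb) (hb1 : γb < 1) (hg0 : 0 < g) (hg1 : g < 1) {β : ℝ} (hβ : β = (1 + γa) * γb)
    (hβ1 : β < 1) {q α : ℕ → ℕ} [∀ k, NeZero (q k)] {ε : ℕ → ℝ} {ε₀ : ℝ} (hε₀ : ε₀ < 1)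
    (hε : ∀ k, 0 < ε k ∧ ε k ≤ ε₀) {F : ℕ → Type*}
    {enc : ∀ k, (Fin k → F k) → (Fin (q k) × Fin (α k) → F k)}
    (henc : ∀ k, CorrectsErasures (enc k) β)
    (hrate : Tendsto (fun k : ℕ => (k : ℝ) / ((q k : ℝ) * (α k : ℝ))) atTop (𝓝 (1 - β)))
    (hsize : ∀ᶠ k : ℕ in atTop, 3000000 * (L / g ^ 3 * Real.log (L / (γb * g))) ≤ (α k : ℝ))
    (hlo : (fun k : ℕ => (α k : ℝ) ^ 2 / (γa ^ 2 * γb ^ 2)) =o[atTop]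
      (fun k : ℕ => (k : ℝ) / Real.log (1 / ε k))) :
    ∀ᶠ k : ℕ in atTop, codeLaw L (q k) (α k)
        {C | ENNReal.ofReal ((1 + g) * (1 / (1 - β)) * ((k : ℝ) / minParam p))
          < averageCodingDelay p (enc k) C} ≤ ENNReal.ofReal (ε k) := by
  have hβ0 : 0 < β := by rw [hβ]; positivity
  have hβ' : 0 < 1 - β := by linarith
  set pm := minParam p with hpm
  have hpm0 : 0 < pm := minParam_pos hL hp0
  have hε₀0 : 0 < ε₀ := (hε 0).1.trans_le (hε 0).2
  set l : ℝ := Real.log (1 / ε₀) with hl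
  have hl0 : 0 < l := Real.log_pos (by rw [lt_div_iff₀ hε₀0]; linarith)
  have hΛ : ∀ k, l ≤ Real.log (1 / ε k) := fun k => by
    have := hε k
    refine Real.log_le_log (by positivity) (one_div_le_one_div_of_le this.1 this.2)
  have hL0 : (0 : ℝ) < L := by exact_mod_cast (by omega : 0 < L)
  obtain ⟨x₂, hx₂, hx₂l⟩ := exists_exp_neg_mul_le
    (c := g / 16 / (2 ^ L / β * (16 / pm))) (by positivity) hl0
  -- The summand 1 yields the factor `ε k`, `x₂` absorbs the constants of the far tail, and `1 / l`
  -- secures `8 ≤ pm * (D * Λ)`.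
  set D : ℝ := 8 * (1 + x₂ + 1 / l) / pm with hD
  have hD0 : 0 < D := by positivity
  obtain ⟨x₁, hx₁, hx₁l⟩ := exists_exp_neg_mul_le (c := g / 16 / (2 * D)) (by positivity) hl0
  -- One `exp (-Λ)` is `ε k`, the other cancels the factor `Λ` of the cutoff, and `x₁` absorbs the
  -- constants.
  set M : ℝ := 2 + x₁ with hM
  have hM0 : 0 < M := by positivity
  -- The little-o hypothesis with this constant is exactly what bounds `M * Λ` by the McDiarmid
  -- exponent.
  set c₀ : ℝ := pm / (16 * L * M) with hc₀
  have hc₀0 : 0 < c₀ := by positivity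
  have hrate1 : ∀ᶠ k : ℕ in atTop, (k : ℝ) / (q k * α k) < 1 :=
    hrate.eventually_lt_const (by linarith)
  -- The gap between `g / 2` and `g` absorbs the convergence of the rate.
  have hrate2 : ∀ᶠ k : ℕ in atTop, (1 - β) * ((1 + g / 2) / (1 + g)) < (k : ℝ) / (q k * α k) := by
    refine hrate.eventually_const_lt ?_
    have : (1 + g / 2) / (1 + g) < 1 := by rw [div_lt_one (by linarith)]; linarith
    nlinarith
  have hlarge : ∀ᶠ k : ℕ in atTop, (⌈40 * L / g⌉₊ : ℝ) / (g / 8) ≤ k :=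
    tendsto_natCast_atTop_atTop.eventually_ge_atTop _
  filter_upwards [hsize, hrate1, hrate2, hlarge, hlo.bound hc₀0] with k hα hr1 hr2 hk hlok
  have hq0 : (0 : ℝ) < q k := by exact_mod_cast Nat.pos_of_ne_zero (NeZero.ne (q k))
  obtain ⟨hy2, hlog⟩ := log_ratio_bounds hL hb0 hb1 hg0 hg1
  have hα0 : (0 : ℝ) < α k := lt_of_lt_of_le (by positivity) hα
  have hn0 : (0 : ℝ) < q k * α k := by positivity
  have hkn : (k : ℝ) ≤ q k * α k := by
    rw [div_lt_one hn0] at hr1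
    exact hr1.le
  set Λ := Real.log (1 / ε k) with hΛk
  have hlΛ : l ≤ Λ := hΛ k
  have hΛ0 : 0 < Λ := hl0.trans_le hlΛ
  have hεΛ : ε k = Real.exp (-Λ) := by
    rw [hΛk, one_div, Real.log_inv, neg_neg, Real.exp_log (hε k).1]
  have hpD : pm * (D * Λ) = 8 * ((1 + x₂ + 1 / l) * Λ) := by rw [hD]; field_simp
  have hlΛ1 : 1 ≤ 1 / l * Λ := by rw [one_div_mul_eq_div, le_div_iff₀ hl0]; linarith
  refine codeLaw_averageCodingDelay_gt_le hL p hpm0 (minParam_le p) ha0 hb0 hb1 hg0 hg1 (hβ ▸ henc k) hα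
    ?_ (hε k).1 (Λ := Λ) (D := D) (M := M) ?_ ?_ ?_ ?_ ?_
  · rw [div_le_iff₀ (by positivity)] at hk
    calc _ ≤ k * (g / 8) := hk
      _ ≤ q k * α k * (g / 8) := by gcongr
      _ = _ := by ring
  · rw [hpD]
    have h1 : (1 + x₂ + 1 / l) * Λ = (1 + x₂) * Λ + 1 / l * Λ := by ring
    have h2 : 0 ≤ (1 + x₂) * Λ := by positivity
    linarith
  · rw [Real.norm_of_nonneg (by positivity), Real.norm_of_nonneg (by positivity)] at hlok
    have h1 : (α k : ℝ) ^ 2 / (γa ^ 2 * γb ^ 2) ≤ c₀ * (q k * α k / Λ) := hlok.trans (by gcongr)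
    have h2 : α k * Λ ≤ c₀ * q k * (γa ^ 2 * γb ^ 2) := by
      rw [div_le_iff₀ (by positivity)] at h1
      have h3 : α k * (α k * Λ) ≤ α k * (c₀ * q k * (γa ^ 2 * γb ^ 2)) := by
        calc α k * (α k * Λ) = (α k : ℝ) ^ 2 * Λ := by ring
          _ ≤ c₀ * (q k * α k / Λ) * (γa ^ 2 * γb ^ 2) * Λ := by gcongr
          _ = _ := by field_simp
      exact le_of_mul_le_mul_left h3 hα0
    rw [le_div_iff₀ (by positivity)]
    calc M * Λ * (16 * (α k * L)) = 16 * L * M * (α k * Λ) := by ring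
      _ ≤ 16 * L * M * (c₀ * q k * (γa ^ 2 * γb ^ 2)) := by gcongr
      _ = _ := by rw [hc₀]; field_simp
  · have h1 : Λ ≤ Real.exp Λ := by linarith [Real.add_one_le_exp Λ]
    have h2 : Real.exp (-(M * Λ)) = Real.exp (-Λ) * Real.exp (-Λ) * Real.exp (-(x₁ * Λ)) := by
      rw [← Real.exp_add, ← Real.exp_add, hM]; ring_nf
    have h3 : Λ * Real.exp (-Λ) ≤ 1 := by
      rw [Real.exp_neg, ← div_eq_mul_inv, div_le_one (Real.exp_pos _)]; exact h1
    have h4 := hx₁l Λ hlΛ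
    rw [le_div_iff₀ (by positivity)] at h4
    calc 2 * (D * Λ) * Real.exp (-(M * Λ))
        = (Λ * Real.exp (-Λ)) * (Real.exp (-(x₁ * Λ)) * (2 * D)) * ε k := by rw [h2, hεΛ]; ring
      _ ≤ 1 * (g / 16) * ε k := by
          have := (hε k).1
          gcongr
      _ = _ := by ring
  · have h1 : Real.exp (-(pm * (D * Λ) / 8)) ≤ Real.exp (-(x₂ * Λ)) * ε k := by
      rw [hεΛ, ← Real.exp_add]
      refine Real.exp_le_exp.2 ?_
      rw [hpD]
      have h2 : (1 + x₂ + 1 / l) * Λ = Λ + x₂ * Λ + 1 / l * Λ := by ring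
      linarith
    have h4 := hx₂l Λ hlΛ
    rw [le_div_iff₀ (by positivity)] at h4
    rw [← hβ]
    calc _ ≤ 2 ^ L / β * (16 / pm) * (Real.exp (-(x₂ * Λ)) * ε k) := by gcongr
      _ = Real.exp (-(x₂ * Λ)) * (2 ^ L / β * (16 / pm)) * ε k := by ring
      _ ≤ _ := by
          have := (hε k).1
          gcongr
  · rw [lt_div_iff₀ hn0] at hr2
    have h2 : (1 + g / 2) * (q k * α k) ≤ (1 + g) * (1 / (1 - β)) * k := by
      calc (1 + g / 2) * (q k * α k)
          = (1 + g) * (1 / (1 - β)) * ((1 - β) * ((1 + g / 2) / (1 + g)) * (q k * α k)) := by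
            field_simp
        _ ≤ _ := by gcongr
    calc (1 + g / 2) * (q k * α k) / pm ≤ (1 + g) * (1 / (1 - β)) * k / pm := by gcongr
      _ = _ := by ring

end Asymptotics

end ChunkedCode

/-! ### The remainder `ρ` and the uniform constant -/

theorem mainTheorem12 :
    -- the term `ρ γa γb = O(γb ^ 2)`
    ∃ ρ : ℝ → ℝ → ℝ,
      (∀ b₀ : ℝ, b₀ < 1 → ∃ K : ℝ, ∀ γa γb : ℝ, 0 < γa → γa < 1 → 0 < γb → γb < 1 →
        (1 + γa) * γb ≤ b₀ → |ρ γa γb| ≤ K * γb ^ 2) ∧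
      -- the constant implied by the `Ω`, as a nondecreasing function of the ratio `γe / γc`
      ∃ Co : ℝ → ℝ, Monotone Co ∧ (∀ x, 0 < Co x) ∧
        ∀ (L : ℕ) (_ : 2 ≤ L)
          (p : Fin L → unitInterval) (_ : ∀ i, 0 < (p i : ℝ)) (_ : Function.Injective p)
          (γa γb γc : ℝ) (_ : 0 < γa) (_ : γa < 1) (_ : 0 < γb) (_ : γb < 1)
          (_ : 0 < γc) (_ : γc < 1) (_ : (1 + γa) * γb < 1)
          (q α : ℕ → ℕ) [∀ k, NeZero (q k)]
          (ε : ℕ → ℝ) (ε₀ : ℝ) (_ : ε₀ < 1) (_ : ∀ k, 0 < ε k ∧ ε k ≤ ε₀)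
          -- the precode: it corrects a fraction `(1 + γa) * γb` of erasures and has rate
          -- asymptotically equal to `1 - (1 + γa) * γb`
          (F : ℕ → Type u)
          (enc : ∀ k, (Fin k → F k) → (Fin (q k) × Fin (α k) → F k))
          (_ : ∀ k, ChunkedCode.CorrectsErasures (enc k) ((1 + γa) * γb))
          (_ : Tendsto (fun k : ℕ => (k : ℝ) / ((q k : ℝ) * (α k : ℝ))) atTop
            (𝓝 (1 - (1 + γa) * γb)))
          -- the two conditions on the size of the chunks
          (_ : ∀ᶠ k : ℕ in atTop,
            Co (ChunkedCode.minGap p / γc) *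
              ((L : ℝ) / (ChunkedCode.minGap p ^ 2 * γc) * Real.log ((L : ℝ) / (γb * γc)))
                ≤ (α k : ℝ))
          (_ : (fun k : ℕ => (α k : ℝ) ^ 2 / (γa ^ 2 * γb ^ 2)) =o[atTop]
            (fun k : ℕ => (k : ℝ) / Real.log (1 / ε k))),
          ∀ᶠ k : ℕ in atTop,
            ChunkedCode.codeLaw L (q k) (α k)
                {C | ENNReal.ofReal
                    ((1 + γc) * (1 + (1 + γa) * γb + ρ γa γb) *
                      ((k : ℝ) / ChunkedCode.minParam p))
                  < ChunkedCode.averageCodingDelay p (enc k) C}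
              ≤ ENNReal.ofReal (ε k) := by
  -- With `β = (1 + γa) γb`, the first witness makes `1 + β + ρ = 1 / (1 - β)`; the 4 bounds `(1 +
  -- γa) ^ 2`. In the last witness `max x 0` gives monotonicity and the summand 1 positivity.
  refine ⟨fun γa γb => ((1 + γa) * γb) ^ 2 / (1 - (1 + γa) * γb), fun b₀ hb₀ => ⟨4 / (1 - b₀),
    fun γa γb ha0 ha1 hb0 hb1 hle => ?_⟩, fun x => 3000000 * (1 + (max x 0) ^ 2), ?_, ?_, ?_⟩
  · have h1 : 0 < 1 - b₀ := by linarith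
    have h2 : 0 < 1 - (1 + γa) * γb := by linarith
    rw [abs_of_nonneg (by positivity), div_mul_eq_mul_div]
    refine div_le_div₀ (by positivity) ?_ h1 (by linarith)
    have : (1 + γa) ^ 2 ≤ 4 := by nlinarith
    nlinarith [sq_nonneg γb]
  · intro x y hxy
    have : max x 0 ≤ max y 0 := max_le_max_right 0 hxy
    dsimp only
    gcongr
  · intro x
    positivity
  intro L hL p hp0 hinj γa γb γc ha0 _ hb0 hb1 hc0 hc1 hβ1 q α _ ε ε₀ hε₀ hε F enc henc hrate
    hsize hlo
  have hgap := ChunkedCode.minGap_pos hL hinj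
  have hlog := (ChunkedCode.log_ratio_bounds hL hb0 hb1 hc0 hc1).2
  have hβ' : 0 < 1 - (1 + γa) * γb := by linarith
  have h1 : 1 + (1 + γa) * γb + ((1 + γa) * γb) ^ 2 / (1 - (1 + γa) * γb)
      = 1 / (1 - (1 + γa) * γb) := by field_simp; ring
  simp only [h1]
  refine ChunkedCode.eventually_codeLaw_averageCodingDelay_gt_le hL hp0 ha0 hb0 hb1 hc0 hc1 rfl hβ1
    hε₀ hε henc hrate ?_ hlo
  filter_upwards [hsize] with k hk
  refine le_trans ?_ hk
  rw [max_eq_left (by positivity)]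
  -- The square of `γe / γc` trades the `γe ^ 2` of the statement for `γc ^ 2`.
  calc 3000000 * (L / γc ^ 3 * Real.log (L / (γb * γc)))
      = 3000000 * (ChunkedCode.minGap p / γc) ^ 2 *
          (L / (ChunkedCode.minGap p ^ 2 * γc) * Real.log (L / (γb * γc))) := by
        field_simp
    _ ≤ _ := by
        gcongr
        linarith
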